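/- Let $a \ge 0$ and $b > 0$ be real numbers, and let $\Omega \subset \mathbb{R}^3$ be the convex hull of the unit disk $\{(x,y,z) : x^2+y^2 \le 1,\ z = 0\}$ and the point $(0,a,b)$. Let $i$ be the imaginary unit, and let $\sqrt{\cdot}$ and $\ln$ denote the principal branches (branch cut along the negative real axis) of the complex square root and logarithm. 1. The mean curvature $H$ (the average of the two principal curvatures, with the sign that makes it nonnegative for a convex body), integrated over the smooth part of the boundary $\partial\Omega$ (that is, over $\partial\Omega$ without its edge and its vertex), satisfies $$\int_{\partial\Omega} H\,dS = \frac{\pi}{2}\left(\sqrt{a^2+(b-i)^2}+\sqrt{a^2+(b+i)^2}\right).$$ 2. The mean width of $\Omega$ (the average, over all directions uniformly distributed on the unit sphere, of the distance between the two supporting planes of $\Omega$ orthogonal to the direction) is $$MW = \frac14\left(\sqrt{a^2+(b-i)^2}+\sqrt{a^2+(b+i)^2}\right) + \frac14\left[\pi + i\ln\left(b-i+\sqrt{a^2+(b-i)^2}\right) - i\ln\left(b+i+\sqrt{a^2+(b+i)^2}\right)\right].$$ 3. In particular, for $a=0$ (a right circular cone), $MW = \dfrac{b+\pi}{2} - \dfrac12\arctan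 b$. -/

import Mathlib

open MeasureTheory
open scoped RealInnerProductSpace

noncomputable section

namespace OC

/-- Euclidean three-space. -/
abbrev E3 : Type := EuclideanSpace ℝ (Fin 3)

/-- The closed unit disk `x² + y² ≤ 1`, `z = 0`. -/
def unitDisk : Set E3 := {p | p 0 ^ 2 + p 1 ^ 2 ≤ 1 ∧ p 2 = 0}

/-- The solid oblique cone: the convex hull of the unit disk and the point `(0, a, b)`. -/
def cone (a b : ℝ) : Set E3 := convexHull ℝ (unitDisk ∪ {!₂[0, a, b]})

/-! ### Mean width -/

/-- The width of `K` in the direction `w`: the distance between the two supporting planes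
of `K` orthogonal to the unit vector `w`. -/
def width (K : Set E3) (w : E3) : ℝ :=
  sSup ((fun p : E3 => ⟪p, w⟫) '' K) - sInf ((fun p : E3 => ⟪p, w⟫) '' K)

/-- The mean width of `K`: the average of the widths over all directions, with respect to the
rotation invariant measure on the unit sphere. -/
def meanWidth (K : Set E3) : ℝ :=
  ⨍ w : Metric.sphere (0 : E3) 1, width K w ∂(volume : Measure E3).toSphere

/-! ### Integrated mean curvature -/

/-- The cross product on Euclidean three-space. -/
def cross (p q : E3) : E3 := WithLp.toLp 2 (crossProduct (WithLp.ofLp p) (WithLp.ofLp q))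

/-- Partial derivative in the first parameter. -/
def du (X : ℝ × ℝ → E3) (p : ℝ × ℝ) : E3 := deriv (fun s : ℝ => X (s, p.2)) p.1

/-- Partial derivative in the second parameter. -/
def dv (X : ℝ × ℝ → E3) (p : ℝ × ℝ) : E3 := deriv (fun t : ℝ => X (p.1, t)) p.2

/-- The unit normal field of a parametrized surface. -/
def unitNormal (X : ℝ × ℝ → E3) (p : ℝ × ℝ) : E3 :=
  ‖cross (du X p) (dv X p)‖⁻¹ • cross (du X p) (dv X p)

/-- Coefficients of the first fundamental form. -/
def coeffE (X : ℝ × ℝ → E3) (p : ℝ × ℝ) : ℝ := ⟪du X p, du X p⟫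

def coeffF (X : ℝ × ℝ → E3) (p : ℝ × ℝ) : ℝ := ⟪du X p, dv X p⟫

def coeffG (X : ℝ × ℝ → E3) (p : ℝ × ℝ) : ℝ := ⟪dv X p, dv X p⟫

/-- Coefficients of the second fundamental form, with the sign for which a convex surface with
outward normal has nonnegative mean curvature. -/
def coeffL (X : ℝ × ℝ → E3) (p : ℝ × ℝ) : ℝ := ⟪du X p, du (unitNormal X) p⟫

def coeffM (X : ℝ × ℝ → E3) (p : ℝ × ℝ) : ℝ :=
  (⟪du X p, dv (unitNormal X) p⟫ + ⟪dv X p, du (unitNormal X) p⟫) / 2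

def coeffN (X : ℝ × ℝ → E3) (p : ℝ × ℝ) : ℝ := ⟪dv X p, dv (unitNormal X) p⟫

/-- The mean curvature `H` of a parametrized surface. -/
def meanCurvature (X : ℝ × ℝ → E3) (p : ℝ × ℝ) : ℝ :=
  (coeffE X p * coeffN X p - 2 * coeffF X p * coeffM X p + coeffG X p * coeffL X p) /
    (2 * (coeffE X p * coeffG X p - coeffF X p ^ 2))

/-- The area density: `dS = √(EG - F²) du dv`. -/
def areaDensity (X : ℝ × ℝ → E3) (p : ℝ × ℝ) : ℝ :=
  Real.sqrt (coeffE X p * coeffG X p - coeffF X p ^ 2)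

/-- The patches `X i`, on the open parameter domains `D i`, parametrize the smooth part of the
boundary of the convex body `K`: they are injective `C²` immersions with pairwise disjoint images
in the boundary, their unit normals point out of `K`, and they miss only a subset of the
boundary of zero area (edges and vertices). -/
structure IsBoundaryParametrization (K : Set E3) {n : ℕ}
    (X : Fin n → ℝ × ℝ → E3) (D : Fin n → Set (ℝ × ℝ)) : Prop where
  isOpen : ∀ i, IsOpen (D i)
  contDiffOn : ∀ i, ContDiffOn ℝ 2 (X i) (D i)
  injOn : ∀ i, Set.InjOn (X i) (D i)
  immersion : ∀ i, ∀ p ∈ D i, cross (du (X i) p) (dv (X i) p) ≠ 0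
  disjoint : ∀ i j, i ≠ j → Disjoint (X i '' D i) (X j '' D j)
  subset_frontier : ∀ i, X i '' D i ⊆ frontier K
  outward : ∀ i, ∀ p ∈ D i, ∀ q ∈ K, ⟪q - X i p, unitNormal (X i) p⟫ ≤ 0
  null_compl : μH[2] (frontier K \ ⋃ i, X i '' D i) = 0

/-- `∫_{∂K} H dS = m`, for a convex body `K` whose boundary is piecewise `C²`. As for every surface
integral, `m` does not depend on the parametrization. Edges and vertices do not contribute. -/
def HasIntegratedMeanCurvature (K : Set E3) (m : ℝ) : Prop :=
  ∃ (n : ℕ) (X : Fin n → ℝ × ℝ → E3) (D : Fin n → Set (ℝ × ℝ)),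
    IsBoundaryParametrization K X D ∧
    (∀ i, IntegrableOn (fun p => meanCurvature (X i) p * areaDensity (X i) p) (D i)) ∧
    ∑ i, ∫ p in D i, meanCurvature (X i) p * areaDensity (X i) p = m

end OC

end

namespace OC

/-! Both quantities reduce to integrals over the angle `φ` of the base circle, and one complex
factorization evaluates all of them. Put `x = 1 - a sin φ`, let `S` be the root of `a² + (b - i)²`
with positive real part, and set `w = b - i + S`, `k = a / w`. Then `|k| < 1` and `x + i b = (i w /
2) (1 + k e^{iφ}) (1 - k e^{-iφ})` (`sub_sin_eq_mul`). The last two factors are boundary values of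
functions holomorphic and zero-free on the closed disk, in `e^{iφ}` and `e^{-iφ}`, so the mean value
property integrates their logarithms and inverses.

Curvature: the base is flat. The lateral surface is ruled with constant normal along each ruling, so
only one curvature survives, and `H dS` depends on `φ` alone. Its density is half the imaginary part
of `-S² / (x + i b)`, whose integral is computed by `integral_inv_sub_sin`.

Mean width: a linear functional on the cone is maximal on the disk or at the apex, so the support
function is an explicit maximum of two terms. Its integral over the sphere is taken in longitude and
latitude. For fixed longitude the latitude integral is elementary (`integral_latitude`), and leaves
an expression in the dihedral angle `edgeAngle = arg (x + i b) = Im log (x + i b)`. Its integrals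
against `1` and `a sin φ` follow from the factorization.

The second radical and logarithm in the statement are conjugates of the first ones, so the sums and
differences there are real and imaginary parts. -/

theorem inner_E3 (p q : E3) : ⟪p, q⟫ = p 0 * q 0 + p 1 * q 1 + p 2 * q 2 := by
  simp [PiLp.inner_apply, Fin.sum_univ_three, mul_comm]

/-! ### Convex geometry of the cone: slices, support function, frontier -/

theorem mem_cone_iff_exists {a b : ℝ} {p : E3} :
    p ∈ cone a b ↔ ∃ s ∈ Set.Icc (0 : ℝ) 1, ∃ x y : ℝ, x ^ 2 + y ^ 2 ≤ 1 ∧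
      p = !₂[(1 - s) * x, (1 - s) * y + s * a, s * b] := by
  have hconv : Convex ℝ unitDisk := by
    intro p hp q hq s t hs ht hst
    obtain ⟨hp, hp2⟩ := hp
    obtain ⟨hq, hq2⟩ := hq
    refine ⟨?_, by simp [hp2, hq2]⟩
    obtain rfl : s = 1 - t := by linarith
    simp only [PiLp.add_apply, PiLp.smul_apply, smul_eq_mul]
    nlinarith [mul_nonneg hs ht, mul_nonneg (mul_nonneg hs ht) (sq_nonneg (p 0 - q 0)),
      mul_nonneg (mul_nonneg hs ht) (sq_nonneg (p 1 - q 1))]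
  have hne : unitDisk.Nonempty := ⟨0, by simp [unitDisk]⟩
  rw [cone, Set.union_comm, ← Set.insert_eq, convexHull_insert hne, hconv.convexHull_eq,
    mem_convexJoin]
  constructor
  · rintro ⟨A, rfl, q, ⟨hq, hq2⟩, s, t, hs, ht, hst, rfl⟩
    refine ⟨s, ⟨hs, by linarith⟩, q 0, q 1, hq, ?_⟩
    obtain rfl : t = 1 - s := by linarith
    ext i
    fin_cases i <;> simp [hq2] <;> ring
  · rintro ⟨s, ⟨hs, hs1⟩, x, y, hxy, rfl⟩
    refine ⟨_, rfl, !₂[x, y, 0], ⟨by simpa using hxy, by simp⟩, s, 1 - s, hs, by linarith,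
      by ring, ?_⟩
    ext i
    fin_cases i <;> simp
    ring

/-- The slice at height `s b` is a disk of radius `1 - s` centred at `(0, s a)`. These inequalities
make the cone closed, and their strict forms give interior points. -/
theorem mem_cone_iff {a b : ℝ} (hb : 0 < b) {p : E3} :
    p ∈ cone a b ↔ 0 ≤ p 2 ∧ p 2 ≤ b ∧
      (p 0) ^ 2 + (p 1 - p 2 / b * a) ^ 2 ≤ (1 - p 2 / b) ^ 2 := by
  rw [mem_cone_iff_exists]
  constructor
  · rintro ⟨s, ⟨hs, hs1⟩, x, y, hxy, rfl⟩
    have h : s * b / b = s := by field_simp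
    simp only [Matrix.cons_val, h]
    refine ⟨by positivity, by nlinarith, ?_⟩
    nlinarith [mul_le_mul_of_nonneg_left hxy (sq_nonneg (1 - s))]
  · rintro ⟨h0, h1, h2⟩
    have hs1 : p 2 / b ≤ 1 := (div_le_one hb).2 h1
    have hz : p 2 / b * b = p 2 := by field_simp
    generalize p 2 / b = s at *
    have hs0 : 0 ≤ s := by
      by_contra hs
      nlinarith
    rcases hs1.lt_or_eq with hs | rfl
    · have : 0 < 1 - s := by linarith
      refine ⟨s, ⟨hs0, hs1⟩, p 0 / (1 - s), (p 1 - s * a) / (1 - s), ?_, ?_⟩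
      · rw [div_pow, div_pow, ← add_div, div_le_one (by positivity)]
        exact h2
      · ext i
        fin_cases i <;> simp [hz] <;> field_simp
        ring
    · refine ⟨1, by simp, 0, 0, by simp, ?_⟩
      have e0 : p 0 = 0 := by nlinarith [sq_nonneg (p 0), sq_nonneg (p 1 - 1 * a)]
      have e1 : p 1 - 1 * a = 0 := by nlinarith [sq_nonneg (p 0), sq_nonneg (p 1 - 1 * a)]
      ext i
      fin_cases i <;> simp [hz, e0]
      linarith

/-- The support function of the oblique cone. -/
noncomputable def supportFun (a b : ℝ) (w : E3) : ℝ :=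
  max (Real.sqrt (w 0 ^ 2 + w 1 ^ 2)) (a * w 1 + b * w 2)

/-- On a convex hull a linear functional is maximal on the generators: on the disk the maximum is
the length of the horizontal part of `w`, and at the apex the value is `a w₁ + b w₂`. -/
theorem isGreatest_inner_cone (a b : ℝ) (w : E3) :
    IsGreatest ((fun p : E3 => ⟪p, w⟫) '' cone a b) (supportFun a b w) := by
  have hr : Real.sqrt (w 0 ^ 2 + w 1 ^ 2) ^ 2 = w 0 ^ 2 + w 1 ^ 2 := Real.sq_sqrt (by positivity)
  have hr0 := Real.sqrt_nonneg (w 0 ^ 2 + w 1 ^ 2)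
  rw [supportFun]
  generalize Real.sqrt (w 0 ^ 2 + w 1 ^ 2) = r at *
  constructor
  · rcases max_choice r (a * w 1 + b * w 2) with h | h
    · rw [h]
      rcases hr0.eq_or_lt with h0 | h0
      · have e0 : w 0 = 0 := by nlinarith [sq_nonneg (w 0), sq_nonneg (w 1)]
        have e1 : w 1 = 0 := by nlinarith [sq_nonneg (w 0), sq_nonneg (w 1)]
        refine ⟨0, mem_cone_iff_exists.2 ⟨0, by simp, 0, 0, by simp, ?_⟩, by simp [← h0]⟩
        ext i
        fin_cases i <;> simp
      · refine ⟨_, mem_cone_iff_exists.2 ⟨0, by simp, w 0 / r, w 1 / r, ?_, rfl⟩, ?_⟩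
        · rw [div_pow, div_pow, ← add_div, hr, div_self]
          nlinarith
        · simp only [inner_E3, Matrix.cons_val]
          field_simp
          linarith
    · rw [h]
      refine ⟨_, mem_cone_iff_exists.2 ⟨1, by simp, 0, 0, by simp, rfl⟩, ?_⟩
      simp [inner_E3]
  · rintro _ ⟨p, hp, rfl⟩
    obtain ⟨s, ⟨hs, hs1⟩, x, y, hxy, rfl⟩ := mem_cone_iff_exists.1 hp
    simp only [inner_E3, Matrix.cons_val]
    have h1 : x * w 0 + y * w 1 ≤ r := by
      refine le_of_sq_le_sq ?_ hr0
      nlinarith [sq_nonneg (x * w 1 - y * w 0), mul_le_mul_of_nonneg_right hxy (sq_nonneg r)]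
    have h2 := mul_le_mul_of_nonneg_left (h1.trans (le_max_left r (a * w 1 + b * w 2)))
      (sub_nonneg.2 hs1)
    have h3 := mul_le_mul_of_nonneg_left (le_max_right r (a * w 1 + b * w 2)) hs
    linarith

theorem width_cone (a b : ℝ) (w : E3) :
    width (cone a b) w = supportFun a b w + supportFun a b (-w) := by
  have h : IsLeast ((fun p : E3 => ⟪p, w⟫) '' cone a b) (-supportFun a b (-w)) := by
    obtain ⟨⟨p, hp, hpw⟩, h2⟩ := isGreatest_inner_cone a b (-w)
    refine ⟨⟨p, hp, ?_⟩, ?_⟩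
    · simp only [← hpw, inner_neg_right, neg_neg]
    · rintro _ ⟨q, hq, rfl⟩
      have := h2 ⟨q, hq, rfl⟩
      simp only [inner_neg_right] at this
      simp only
      linarith
  rw [width, (isGreatest_inner_cone a b w).csSup_eq, h.csInf_eq]
  ring

theorem isClosed_cone {a b : ℝ} (hb : 0 < b) : IsClosed (cone a b) := by
  have : cone a b = {p | 0 ≤ p 2} ∩ {p | p 2 ≤ b} ∩
      {p | (p 0) ^ 2 + (p 1 - p 2 / b * a) ^ 2 ≤ (1 - p 2 / b) ^ 2} := by
    ext p
    simp [mem_cone_iff hb, and_assoc]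
  rw [this]
  exact ((isClosed_le (by fun_prop) (by fun_prop)).inter
    (isClosed_le (by fun_prop) (by fun_prop))).inter (isClosed_le (by fun_prop) (by fun_prop))

theorem mem_interior_cone {a b : ℝ} (hb : 0 < b) {p : E3} (h0 : 0 < p 2) (h1 : p 2 < b)
    (h2 : (p 0) ^ 2 + (p 1 - p 2 / b * a) ^ 2 < (1 - p 2 / b) ^ 2) :
    p ∈ interior (cone a b) := by
  refine mem_interior.2 ⟨{p | 0 < p 2} ∩ {p | p 2 < b} ∩
      {p | (p 0) ^ 2 + (p 1 - p 2 / b * a) ^ 2 < (1 - p 2 / b) ^ 2}, ?_, ?_, ⟨⟨h0, h1⟩, by exact h2⟩⟩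
  · rintro q ⟨⟨h0 : 0 < q 2, h1 : q 2 < b⟩, h2⟩
    exact (mem_cone_iff hb).2 ⟨h0.le, h1.le, le_of_lt (by exact h2)⟩
  · exact ((isOpen_lt (by fun_prop) (by fun_prop)).inter
      (isOpen_lt (by fun_prop) (by fun_prop))).inter (isOpen_lt (by fun_prop) (by fun_prop))

theorem exists_of_mem_frontier_cone {a b : ℝ} (hb : 0 < b) {p : E3} (hp : p ∈ frontier (cone a b)) :
    (∃ x y : ℝ, x ^ 2 + y ^ 2 ≤ 1 ∧ p = !₂[x, y, 0]) ∨
    ∃ s ∈ Set.Icc (0 : ℝ) 1, ∃ x y : ℝ, x ^ 2 + y ^ 2 = 1 ∧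
      p = !₂[(1 - s) * x, (1 - s) * y + s * a, s * b] := by
  have hpc : p ∈ cone a b := (isClosed_cone hb).frontier_subset hp
  obtain ⟨s, ⟨hs, hs1⟩, x, y, hxy, rfl⟩ := mem_cone_iff_exists.1 hpc
  rcases hs.eq_or_lt with rfl | hs'
  · left
    exact ⟨x, y, hxy, by simp⟩
  right
  rcases hs1.eq_or_lt with rfl | hs1'
  · exact ⟨1, by simp, 1, 0, by simp, by simp⟩
  refine ⟨s, ⟨hs, hs1⟩, x, y, hxy.eq_of_not_lt fun hlt => hp.2 ?_, rfl⟩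
  have h : s * b / b = s := by field_simp
  apply mem_interior_cone hb <;> simp only [Matrix.cons_val, h]
  · positivity
  · nlinarith
  · have : 0 < 1 - s := by linarith
    nlinarith [mul_lt_mul_of_pos_left hlt (pow_pos this 2)]

/-- An arbitrarily small move from `p` along `n` leaves the supporting half-space, hence `K`. -/
theorem mem_frontier_of_forall_inner_le {K : Set E3} {p n : E3} (hp : p ∈ K) (hn : n ≠ 0)
    (h : ∀ q ∈ K, ⟪q - p, n⟫ ≤ 0) : p ∈ frontier K := by
  refine ⟨subset_closure hp, fun hi => ?_⟩
  have hc : Filter.Tendsto (fun t : ℝ => p + t • n) (nhdsWithin 0 (Set.Ioi 0)) (nhds p) := by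
    have : Continuous fun t : ℝ => p + t • n := by fun_prop
    simpa using (this.tendsto 0).mono_left nhdsWithin_le_nhds
  have h1 := hc.eventually (mem_interior_iff_mem_nhds.1 hi)
  obtain ⟨t, ht, ht0⟩ := (h1.and self_mem_nhdsWithin).exists
  have := h _ ht
  rw [add_sub_cancel_left, inner_smul_left, real_inner_self_eq_norm_sq] at this
  have h3 : 0 < ‖n‖ ^ 2 := by positivity
  have h4 : 0 < t := ht0
  simp only [conj_trivial] at this
  nlinarith [mul_pos h4 h3]

/-! ### Mean value integrals over the unit circle -/

open Complex in
theorem integral_exp_mul_I {f : ℂ → ℂ} (hf : DifferentiableOn ℂ f (Metric.closedBall 0 1)) :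
    ∫ φ in -Real.pi..Real.pi, f (exp (φ * I)) = 2 * Real.pi * f 0 := by
  have hd : DiffContOnCl ℂ f (Metric.ball 0 |1|) := by
    apply DifferentiableOn.diffContOnCl
    rwa [abs_one, closure_ball _ one_ne_zero]
  have h := hd.circleAverage
  rw [Real.circleAverage_def] at h
  have hp : Function.Periodic (fun φ : ℝ => f (circleMap 0 1 φ)) (2 * Real.pi) :=
    (periodic_circleMap 0 1).comp f
  have hi := hp.intervalIntegral_add_eq (-Real.pi) 0
  rw [show -Real.pi + 2 * Real.pi = Real.pi by ring, zero_add] at hi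
  rw [← hi] at h
  simp only [circleMap, ofReal_one, one_mul, zero_add] at h
  rw [← h, real_smul]
  push_cast
  rw [mul_inv_cancel_left₀ (by simp)]

open Complex in
theorem integral_exp_neg_mul_I {f : ℂ → ℂ} (hf : DifferentiableOn ℂ f (Metric.closedBall 0 1)) :
    ∫ φ in -Real.pi..Real.pi, f (exp (-φ * I)) = 2 * Real.pi * f 0 := by
  have h := intervalIntegral.integral_comp_neg (a := -Real.pi) (b := Real.pi)
    (fun φ : ℝ => f (exp (φ * I)))
  rw [neg_neg, integral_exp_mul_I hf] at h
  simpa using h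

theorem one_add_mem_slitPlane {z : ℂ} (hz : ‖z‖ < 1) : 1 + z ∈ Complex.slitPlane := by
  left
  have := (abs_le.1 (Complex.abs_re_le_norm z)).1
  simp only [Complex.add_re, Complex.one_re]
  linarith

theorem norm_mul_lt_one {k z : ℂ} (hk : ‖k‖ < 1) (hz : ‖z‖ ≤ 1) : ‖k * z‖ < 1 := by
  rw [norm_mul]
  exact (mul_le_of_le_one_right (norm_nonneg k) hz).trans_lt hk

theorem differentiableAt_log_one_add_mul {k z : ℂ} (hk : ‖k‖ < 1) (hz : ‖z‖ ≤ 1) :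
    DifferentiableAt ℂ (fun z => Complex.log (1 + k * z)) z :=
  DifferentiableAt.clog (by fun_prop) (one_add_mem_slitPlane (norm_mul_lt_one hk hz))

open Complex in
theorem integral_log_one_add {k : ℂ} (hk : ‖k‖ < 1) :
    ∫ φ in -Real.pi..Real.pi, log (1 + k * exp (φ * I)) = 0 := by
  have := integral_exp_mul_I (f := fun z => log (1 + k * z)) fun z hz =>
    (differentiableAt_log_one_add_mul hk (by simpa using hz)).differentiableWithinAt
  simpa using this

open Complex in
theorem integral_log_one_add_neg {k : ℂ} (hk : ‖k‖ < 1) :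
    ∫ φ in -Real.pi..Real.pi, log (1 + k * exp (-φ * I)) = 0 := by
  have := integral_exp_neg_mul_I (f := fun z => log (1 + k * z)) fun z hz =>
    (differentiableAt_log_one_add_mul hk (by simpa using hz)).differentiableWithinAt
  simpa using this

open Complex in
theorem integral_inv_one_add {k : ℂ} (hk : ‖k‖ < 1) :
    ∫ φ in -Real.pi..Real.pi, (1 + k * exp (φ * I))⁻¹ = 2 * Real.pi := by
  have := integral_exp_mul_I (f := fun z => (1 + k * z)⁻¹) fun z hz => by
    refine (DifferentiableAt.inv (by fun_prop) ?_).differentiableWithinAt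
    exact slitPlane_ne_zero (one_add_mem_slitPlane (norm_mul_lt_one hk (by simpa using hz)))
  simpa using this

open Complex in
theorem integral_inv_one_add_neg {k : ℂ} (hk : ‖k‖ < 1) :
    ∫ φ in -Real.pi..Real.pi, (1 + k * exp (-φ * I))⁻¹ = 2 * Real.pi := by
  have := integral_exp_neg_mul_I (f := fun z => (1 + k * z)⁻¹) fun z hz => by
    refine (DifferentiableAt.inv (by fun_prop) ?_).differentiableWithinAt
    exact slitPlane_ne_zero (one_add_mem_slitPlane (norm_mul_lt_one hk (by simpa using hz)))
  simpa using this

-- With `z = e^{iφ}` and `g z = log (1 + k z)`, the integrand is `(z g(z) - g(z) / z) / (2i)`. Since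
-- `g 0 = 0` the singularity is removable, and `dslope` fills it in with `g' 0 = k`; the mean value
-- at `0` is then `-k / (2i)`.
open Complex in
theorem integral_sin_mul_log_one_add {k : ℂ} (hk : ‖k‖ < 1) :
    ∫ φ in -Real.pi..Real.pi, (Real.sin φ : ℂ) * log (1 + k * exp (φ * I)) =
      Real.pi * I * k := by
  set g : ℂ → ℂ := fun z => log (1 + k * z) with hg
  have hgd : ∀ z, ‖z‖ ≤ 1 → DifferentiableAt ℂ g z := fun z hz =>
    differentiableAt_log_one_add_mul hk hz
  have hgo : DifferentiableOn ℂ g (Metric.closedBall 0 1) := fun z hz =>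
    (hgd z (by simpa using hz)).differentiableWithinAt
  have hg0 : g 0 = 0 := by simp [hg]
  have hg' : deriv g 0 = k := by
    have h : HasDerivAt (fun z => 1 + k * z) k 0 := by
      simpa using ((hasDerivAt_id (0 : ℂ)).const_mul k).const_add 1
    have := h.clog (by simp)
    simpa [hg] using this.deriv
  have hd : DifferentiableOn ℂ (fun z => (z * g z - dslope g 0 z) / (2 * I))
      (Metric.closedBall 0 1) := by
    have := (Complex.differentiableOn_dslope
      (Metric.closedBall_mem_nhds (0 : ℂ) one_pos)).2 hgo
    exact ((differentiableOn_id.mul hgo).sub this).div_const _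
  have h := integral_exp_mul_I hd
  simp only [dslope_same, hg', zero_mul, zero_sub] at h
  calc _ = _ := intervalIntegral.integral_congr fun φ _ => ?_
    _ = _ := h
    _ = _ := by
      field_simp
      rw [I_sq]
      ring
  have he : exp (φ * I) ≠ 0 := exp_ne_zero _
  simp only [dslope_of_ne g he, slope_def_field, hg0, sub_zero]
  rw [show log (1 + k * exp (φ * I)) = g (exp (φ * I)) from rfl, ofReal_sin, Complex.sin,
    show -(φ : ℂ) * I = -(φ * I) by ring, exp_neg]
  generalize g (exp (φ * I)) = G
  generalize exp (φ * I) = z at *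
  field_simp
  rw [I_sq]
  ring

open Complex in
theorem integral_sin_mul_log_one_add_neg {k : ℂ} (hk : ‖k‖ < 1) :
    ∫ φ in -Real.pi..Real.pi, (Real.sin φ : ℂ) * log (1 + k * exp (-φ * I)) =
      -(Real.pi * I * k) := by
  have h := intervalIntegral.integral_comp_neg (a := -Real.pi) (b := Real.pi)
    (fun φ : ℝ => (Real.sin φ : ℂ) * log (1 + k * exp (φ * I)))
  rw [neg_neg, integral_sin_mul_log_one_add hk] at h
  rw [← h, ← intervalIntegral.integral_neg]
  congr 1
  ext φ
  simp

/-! ### The edge angle and the factorization of `x + i b` -/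

/-- The interior dihedral angle between the base and the lateral surface of the oblique cone,
at the point `(cos φ, sin φ, 0)` of the edge. -/
noncomputable def edgeAngle (a b φ : ℝ) : ℝ := Real.pi / 2 - Real.arctan ((1 - a * Real.sin φ) / b)

theorem continuous_edgeAngle (a b : ℝ) : Continuous (edgeAngle a b) := by
  unfold edgeAngle
  fun_prop

theorem arg_eq_pi_div_two_sub_arctan {x b : ℝ} (hb : 0 < b) :
    Complex.arg (x + b * Complex.I) = Real.pi / 2 - Real.arctan (x / b) := by
  have h1 := Real.neg_pi_div_two_lt_arctan (x / b)
  have h2 := Real.arctan_lt_pi_div_two (x / b)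
  have hc := Real.cos_arctan_pos (x / b)
  have ht : Real.sin (Real.arctan (x / b)) = x / b * Real.cos (Real.arctan (x / b)) := by
    rw [← Real.tan_mul_cos hc.ne', Real.tan_arctan]
  generalize Real.arctan (x / b) = t at *
  have h := Complex.arg_mul_cos_add_sin_mul_I (r := b / Real.cos t) (by positivity)
    (θ := Real.pi / 2 - t) ⟨by linarith [Real.pi_pos], by linarith⟩
  rw [← h, ← Complex.ofReal_cos, ← Complex.ofReal_sin, Real.cos_pi_div_two_sub,
    Real.sin_pi_div_two_sub, ht]
  congr 1
  push_cast
  have : Complex.cos t ≠ 0 := by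
    rw [← Complex.ofReal_cos]
    exact Complex.ofReal_ne_zero.2 hc.ne'
  have : (b : ℂ) ≠ 0 := Complex.ofReal_ne_zero.2 hb.ne'
  field_simp

section

variable {a b : ℝ} {S : ℂ}

/-- The imaginary part of `S²` is `-2 b`, so the real and imaginary parts of `S` have opposite
signs. -/
theorem sqrt_im_neg (hb : 0 < b) (hS : S ^ 2 = (a : ℂ) ^ 2 + ((b : ℂ) - Complex.I) ^ 2)
    (hre : 0 < S.re) : S.im < 0 := by
  have h := congrArg Complex.im hS
  simp [pow_two] at h
  by_contra! h'
  nlinarith [mul_nonneg hre.le h']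

theorem add_sqrt_re_pos (hb : 0 < b) (hre : 0 < S.re) : 0 < ((b : ℂ) - Complex.I + S).re := by
  simp
  positivity

theorem add_sqrt_ne_zero (hb : 0 < b) (hre : 0 < S.re) : (b : ℂ) - Complex.I + S ≠ 0 := by
  intro h
  have := add_sqrt_re_pos hb hre
  simp [h] at this

/-- Here `a² = (S - (b - i)) (S + (b - i))`. The first factor has the smaller norm because `S` and
`b - i` make an acute angle: their real inner product is `b Re S - Im S > 0`. -/
theorem norm_div_add_sqrt_lt_one (hb : 0 < b)
    (hS : S ^ 2 = (a : ℂ) ^ 2 + ((b : ℂ) - Complex.I) ^ 2) (hre : 0 < S.re) :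
    ‖(a : ℂ) / ((b : ℂ) - Complex.I + S)‖ < 1 := by
  have hw := add_sqrt_ne_zero hb hre
  have him := sqrt_im_neg hb hS hre
  rw [norm_div, div_lt_one (norm_pos_iff.2 hw)]
  have h1 : ‖S - (b - Complex.I)‖ < ‖(b : ℂ) - Complex.I + S‖ := by
    apply lt_of_pow_lt_pow_left₀ 2 (norm_nonneg _)
    rw [Complex.sq_norm, Complex.sq_norm, Complex.normSq_apply, Complex.normSq_apply]
    simp
    nlinarith [mul_pos hb hre]
  have h2 : ‖(a : ℂ)‖ ^ 2 = ‖S - (b - Complex.I)‖ * ‖(b : ℂ) - Complex.I + S‖ := by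
    rw [← norm_pow, ← norm_mul]
    congr 1
    linear_combination -hS
  have h3 : 0 < ‖(b : ℂ) - Complex.I + S‖ := norm_pos_iff.2 hw
  apply lt_of_pow_lt_pow_left₀ 2 (norm_nonneg _)
  rw [h2, pow_two]
  gcongr

-- Since `a² / w = S - (b - i)`, one has `w - a² / w = 2 (b - i)`: this is the constant term of the
-- expanded product, while the terms in `e^{±iφ}` combine to `-a sin φ`.
open Complex in
theorem sub_sin_eq_mul (hb : 0 < b) (hS : S ^ 2 = (a : ℂ) ^ 2 + ((b : ℂ) - I) ^ 2)
    (hre : 0 < S.re) (φ : ℝ) :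
    ((1 - a * Real.sin φ : ℝ) : ℂ) + b * I = I * (b - I + S) / 2 *
      (1 + a / (b - I + S) * exp (φ * I)) * (1 + -(a / (b - I + S)) * exp (-φ * I)) := by
  have hw := add_sqrt_ne_zero hb hre
  have he : exp (φ * I) ≠ 0 := exp_ne_zero _
  have hS' : (S - (b - I)) * (b - I + S) = a ^ 2 := by linear_combination hS
  push_cast
  rw [Complex.sin, show -(φ : ℂ) * I = -(φ * I) by ring, exp_neg]
  generalize exp (φ * I) = z at *
  have h1 : (b : ℂ) - I + S = S - (b - I) + 2 * (b - I) := by ring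
  set w := (b : ℂ) - I + S with hwdef
  have h2 : (b : ℂ) - I = (w - a ^ 2 / w) / 2 := by
    rw [← hS', mul_div_cancel_right₀ _ hw, hwdef]
    ring
  have h3 : (1 : ℂ) + b * I = I * ((b : ℂ) - I) := by
    linear_combination I_sq
  have h4 : (1 : ℂ) - a * ((z⁻¹ - z) * I / 2) + b * I
      = I * ((w - a ^ 2 / w) / 2) - a * ((z⁻¹ - z) * I / 2) := by
    rw [← h2, ← h3]
    ring
  rw [h4]
  field_simp
  ring

-- Exponentiating gives the factorization, so the two sides differ by `2πi n`. Bounds on the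
-- arguments force `n = 0`, so the principal branch splits with no correction.
open Complex in
theorem log_sub_sin (hb : 0 < b) (hS : S ^ 2 = (a : ℂ) ^ 2 + ((b : ℂ) - I) ^ 2)
    (hre : 0 < S.re) (φ : ℝ) :
    log (((1 - a * Real.sin φ : ℝ) : ℂ) + b * I) = (log (b - I + S) + Real.pi / 2 * I - Real.log 2) +
      log (1 + a / (b - I + S) * exp (φ * I)) + log (1 + -(a / (b - I + S)) * exp (-φ * I)) := by
  have hw := add_sqrt_ne_zero hb hre
  have hk := norm_div_add_sqrt_lt_one hb hS hre
  have h := sub_sin_eq_mul hb hS hre φ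
  have hwre := add_sqrt_re_pos hb hre
  have n1 : ‖a / (b - I + S) * exp (φ * I)‖ < 1 :=
    norm_mul_lt_one hk (norm_exp_ofReal_mul_I φ).le
  have n2 : ‖-(a / (b - I + S)) * exp (-φ * I)‖ < 1 :=
    norm_mul_lt_one (by rwa [norm_neg]) (by simpa using (norm_exp_ofReal_mul_I (-φ)).le)
  have s1 := one_add_mem_slitPlane n1
  have s2 := one_add_mem_slitPlane n2
  have r1 : 0 < (1 + a / (b - I + S) * exp (φ * I)).re := by
    have := (abs_le.1 (abs_re_le_norm (a / (b - I + S) * exp (φ * I)))).1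
    rw [add_re, one_re]
    linarith
  have r2 : 0 < (1 + -(a / (b - I + S)) * exp (-φ * I)).re := by
    have := (abs_le.1 (abs_re_le_norm (-(a / (b - I + S)) * exp (-φ * I)))).1
    rw [add_re, one_re]
    linarith
  generalize 1 + a / (b - I + S) * exp (φ * I) = u at *
  generalize 1 + -(a / (b - I + S)) * exp (-φ * I) = v at *
  generalize (b : ℂ) - I + S = w at *
  have hne : ((1 - a * Real.sin φ : ℝ) : ℂ) + b * I ≠ 0 := fun h0 => by
    have := congrArg im h0
    simp at this
    exact hb.ne' this
  have hexp : exp (log (((1 - a * Real.sin φ : ℝ) : ℂ) + b * I)) =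
      exp ((log w + Real.pi / 2 * I - Real.log 2) + log u + log v) := by
    rw [exp_log hne, exp_add, exp_add, exp_sub, exp_add, exp_log hw, exp_log (slitPlane_ne_zero s1),
      exp_log (slitPlane_ne_zero s2), exp_pi_div_two_mul_I, ← ofReal_exp,
      Real.exp_log two_pos, h]
    push_cast
    ring
  obtain ⟨n, hn⟩ := exp_eq_exp_iff_exists_int.1 hexp
  have him := congrArg im hn
  have a1 := abs_lt.1 (abs_arg_lt_pi_div_two_iff.2 (Or.inl r1))
  have a2 := abs_lt.1 (abs_arg_lt_pi_div_two_iff.2 (Or.inl r2))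
  have a3 := abs_lt.1 (abs_arg_lt_pi_div_two_iff.2 (Or.inl hwre))
  have a4 := arg_eq_pi_div_two_sub_arctan (x := 1 - a * Real.sin φ) hb
  have a5 := Real.neg_pi_div_two_lt_arctan ((1 - a * Real.sin φ) / b)
  have a6 := Real.arctan_lt_pi_div_two ((1 - a * Real.sin φ) / b)
  have hpi := Real.pi_pos
  rw [log_im, a4] at him
  have him' : Real.pi / 2 - Real.arctan ((1 - a * Real.sin φ) / b) =
      w.arg + Real.pi / 2 + u.arg + v.arg + n * (2 * Real.pi) := by
    rw [him]
    simp [log_im]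
  -- The left side lies in `(0, π)`. The arguments of `w`, `u`, `v` lie in `(-π/2, π/2)`, so their
  -- sum with `π/2` lies in `(-π, 2π)`. The difference is therefore less than `2π` in absolute
  -- value.
  have hn1 : n < 1 := by
    by_contra! hc
    have : (1 : ℝ) ≤ n := by exact_mod_cast hc
    nlinarith
  have hn2 : -1 < n := by
    by_contra! hc
    have : (n : ℝ) ≤ -1 := by exact_mod_cast hc
    nlinarith
  obtain rfl : n = 0 := by omega
  simpa using hn

theorem log_sub_sin_im (hb : 0 < b) (φ : ℝ) :
    (Complex.log (((1 - a * Real.sin φ : ℝ) : ℂ) + b * Complex.I)).im = edgeAngle a b φ := by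
  rw [Complex.log_im, arg_eq_pi_div_two_sub_arctan hb, edgeAngle]

theorem continuous_log_one_add {k : ℂ} (hk : ‖k‖ < 1) :
    Continuous fun φ : ℝ => Complex.log (1 + k * Complex.exp (φ * Complex.I)) := by
  refine Continuous.clog (by fun_prop) fun φ => one_add_mem_slitPlane ?_
  exact norm_mul_lt_one hk (Complex.norm_exp_ofReal_mul_I φ).le

theorem continuous_log_one_add_neg {k : ℂ} (hk : ‖k‖ < 1) :
    Continuous fun φ : ℝ => Complex.log (1 + k * Complex.exp (-φ * Complex.I)) := by
  simpa [Function.comp_def] using (continuous_log_one_add hk).comp continuous_neg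

theorem continuous_log_sub_sin (hb : 0 < b) :
    Continuous fun φ : ℝ =>
      Complex.log (((1 - a * Real.sin φ : ℝ) : ℂ) + b * Complex.I) := by
  refine Continuous.clog (by fun_prop) fun φ => Or.inr ?_
  simpa using hb.ne'

theorem intervalIntegral_im {f : ℝ → ℂ} (hf : Continuous f) (x y : ℝ) :
    ∫ φ in x..y, (f φ).im = (∫ φ in x..y, f φ).im :=
  Complex.imCLM.intervalIntegral_comp_comm (hf.intervalIntegrable x y)

-- The two logarithmic factors have mean zero, so only the constant `log w + iπ/2 - log 2`
-- contributes, through its imaginary part.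
open Complex in
theorem integral_edgeAngle (hb : 0 < b) (hS : S ^ 2 = (a : ℂ) ^ 2 + ((b : ℂ) - I) ^ 2)
    (hre : 0 < S.re) :
    ∫ φ in -Real.pi..Real.pi, edgeAngle a b φ =
      2 * Real.pi * (Real.pi / 2 + arg (b - I + S)) := by
  have hk := norm_div_add_sqrt_lt_one hb hS hre
  have hk' : ‖-(a / ((b : ℂ) - I + S))‖ < 1 := by rwa [norm_neg]
  simp only [← log_sub_sin_im hb]
  rw [intervalIntegral_im (continuous_log_sub_sin hb)]
  simp only [log_sub_sin hb hS hre]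
  have c1 := (continuous_log_one_add hk).intervalIntegrable (-Real.pi) Real.pi (μ := volume)
  have c2 := (continuous_log_one_add_neg hk').intervalIntegrable (-Real.pi) Real.pi (μ := volume)
  rw [intervalIntegral.integral_add (intervalIntegrable_const.add c1) c2,
    intervalIntegral.integral_add intervalIntegrable_const c1, integral_log_one_add hk,
    integral_log_one_add_neg hk', intervalIntegral.integral_const]
  simp [log_im]
  ring

-- Now the constant integrates to zero against `sin`, and each logarithmic factor gives `πik`.
-- Multiplication by `a` turns `k` into `a k = S - (b - i)`.
open Complex in
theorem integral_sin_mul_edgeAngle (hb : 0 < b) (hS : S ^ 2 = (a : ℂ) ^ 2 + ((b : ℂ) - I) ^ 2)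
    (hre : 0 < S.re) :
    ∫ φ in -Real.pi..Real.pi, a * Real.sin φ * edgeAngle a b φ = 2 * Real.pi * (S.re - b) := by
  have hk := norm_div_add_sqrt_lt_one hb hS hre
  have hk' : ‖-(a / ((b : ℂ) - I + S))‖ < 1 := by rwa [norm_neg]
  have hw := add_sqrt_ne_zero hb hre
  have key : ∫ φ in -Real.pi..Real.pi, (Real.sin φ : ℂ) *
      log (((1 - a * Real.sin φ : ℝ) : ℂ) + b * I) = 2 * Real.pi * I * (a / (b - I + S)) := by
    simp only [log_sub_sin hb hS hre, mul_add]
    have c0 : IntervalIntegrable (fun φ : ℝ => (Real.sin φ : ℂ) *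
        (log (b - I + S) + Real.pi / 2 * I - Real.log 2)) volume (-Real.pi) Real.pi :=
      Continuous.intervalIntegrable (by fun_prop) _ _
    have cs : Continuous fun φ : ℝ => (Real.sin φ : ℂ) := by fun_prop
    have c1 := (cs.fun_mul (continuous_log_one_add hk)).intervalIntegrable
      (-Real.pi) Real.pi (μ := volume)
    have c2 := (cs.fun_mul (continuous_log_one_add_neg hk')).intervalIntegrable
      (-Real.pi) Real.pi (μ := volume)
    rw [intervalIntegral.integral_add (c0.add c1) c2, intervalIntegral.integral_add c0 c1,
      integral_sin_mul_log_one_add hk, integral_sin_mul_log_one_add_neg hk',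
      intervalIntegral.integral_mul_const, intervalIntegral.integral_ofReal, integral_sin]
    simp
    ring
  have h2 : ∀ φ : ℝ, a * Real.sin φ * edgeAngle a b φ = a * ((Real.sin φ : ℂ) *
      log (((1 - a * Real.sin φ : ℝ) : ℂ) + b * I)).im := fun φ => by
    rw [im_ofReal_mul, log_sub_sin_im hb, mul_assoc]
  simp only [h2]
  have cs : Continuous fun φ : ℝ => (Real.sin φ : ℂ) := by fun_prop
  rw [intervalIntegral.integral_const_mul,
    intervalIntegral_im (cs.fun_mul (continuous_log_sub_sin hb)), key]
  have h3 : (a : ℂ) * (a / (b - I + S)) = S - (b - I) := by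
    field_simp
    linear_combination -hS
  have h4 := congrArg re h3
  rw [re_ofReal_mul] at h4
  rw [show 2 * (Real.pi : ℂ) * I * (a / (b - I + S)) =
    ((2 * Real.pi : ℝ) : ℂ) * (I * (a / (b - I + S))) by push_cast; ring, im_ofReal_mul, I_mul_im]
  simp only [sub_re, ofReal_re, I_re] at h4
  linear_combination 2 * Real.pi * h4

-- Partial fractions, using `w (1 + k²) = 2 S`: the inverse is `1 / (i S)` times `(1 + k z)⁻¹ + (1 -
-- k / z)⁻¹ - 1`, where `z = e^{iφ}`, and each of the two inverses has mean `1`.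
open Complex in
theorem integral_inv_sub_sin (hb : 0 < b) (hS : S ^ 2 = (a : ℂ) ^ 2 + ((b : ℂ) - I) ^ 2)
    (hre : 0 < S.re) :
    ∫ φ in -Real.pi..Real.pi, (((1 - a * Real.sin φ : ℝ) : ℂ) + b * I)⁻¹ =
      2 * Real.pi / (I * S) := by
  have hk := norm_div_add_sqrt_lt_one hb hS hre
  have hk' : ‖-(a / ((b : ℂ) - I + S))‖ < 1 := by rwa [norm_neg]
  have hw := add_sqrt_ne_zero hb hre
  have hS0 : S ≠ 0 := fun h => by simp [h] at hre
  have n1 : ∀ φ : ℝ, 1 + a / (b - I + S) * exp (φ * I) ≠ 0 := fun φ => slitPlane_ne_zero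
    (one_add_mem_slitPlane (norm_mul_lt_one hk (norm_exp_ofReal_mul_I φ).le))
  have n2 : ∀ φ : ℝ, 1 + -(a / (b - I + S)) * exp (-φ * I) ≠ 0 := fun φ => slitPlane_ne_zero
    (one_add_mem_slitPlane (norm_mul_lt_one hk' (by simpa using (norm_exp_ofReal_mul_I (-φ)).le)))
  have h : ∀ φ : ℝ, (((1 - a * Real.sin φ : ℝ) : ℂ) + b * I)⁻¹ = (I * S)⁻¹ *
      ((1 + a / (b - I + S) * exp (φ * I))⁻¹ + (1 + -(a / (b - I + S)) * exp (-φ * I))⁻¹ - 1) := by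
    intro φ
    have he : exp (φ * I) ≠ 0 := exp_ne_zero _
    have hS2 : 2 * S = (b - I + S) * (1 + (a / (b - I + S)) ^ 2) := by
      field_simp
      linear_combination hS
    have m1 := n1 φ
    have m2 := n2 φ
    rw [sub_sin_eq_mul hb hS hre φ]
    rw [show -(φ : ℂ) * I = -(φ * I) by ring, exp_neg] at *
    have hIS : I * S ≠ 0 := mul_ne_zero I_ne_zero hS0
    rw [inv_eq_iff_eq_inv]
    generalize (a : ℂ) / (b - I + S) = k at *
    have e1 : (1 + k * exp (φ * I))⁻¹ + (1 + -k * (exp (φ * I))⁻¹)⁻¹ - 1 =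
        (1 + k ^ 2) / ((1 + k * exp (φ * I)) * (1 + -k * (exp (φ * I))⁻¹)) := by
      rw [eq_div_iff (mul_ne_zero m1 m2)]
      have x1 := inv_mul_cancel₀ m1
      have x2 := inv_mul_cancel₀ m2
      have x3 := mul_inv_cancel₀ he
      linear_combination (1 + -k * (exp (φ * I))⁻¹) * x1 + (1 + k * exp (φ * I)) * x2 +
        k ^ 2 * x3
    have hkk : 1 + k ^ 2 ≠ 0 := fun h0 => by
      rw [h0, mul_zero] at hS2
      exact hS0 (by simpa using hS2)
    rw [e1, mul_inv, inv_inv, inv_div, mul_div_assoc', eq_div_iff hkk]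
    linear_combination -(I / 2) * ((1 + k * exp (φ * I)) * (1 + -k * (exp (φ * I))⁻¹)) * hS2
  simp only [h]
  have c1 : IntervalIntegrable (fun φ : ℝ => (1 + a / (b - I + S) * exp (φ * I))⁻¹) volume
      (-Real.pi) Real.pi := (Continuous.inv₀ (by fun_prop) n1).intervalIntegrable _ _
  have c2 : IntervalIntegrable (fun φ : ℝ => (1 + -(a / (b - I + S)) * exp (-φ * I))⁻¹) volume
      (-Real.pi) Real.pi := (Continuous.inv₀ (by fun_prop) n2).intervalIntegrable _ _
  rw [intervalIntegral.integral_const_mul,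
    intervalIntegral.integral_sub (c1.add c2) intervalIntegrable_const,
    intervalIntegral.integral_add c1 c2, integral_inv_one_add hk, integral_inv_one_add_neg hk',
    intervalIntegral.integral_const]
  simp only [real_smul]
  push_cast
  rw [div_eq_mul_inv]
  ring

open Complex in
theorem integral_curvature_density (hb : 0 < b) (hS : S ^ 2 = (a : ℂ) ^ 2 + ((b : ℂ) - I) ^ 2)
    (hre : 0 < S.re) :
    ∫ φ in -Real.pi..Real.pi, b * (b ^ 2 + 1 + a ^ 2 - 2 * a * Real.sin φ) /
      (b ^ 2 + (1 - a * Real.sin φ) ^ 2) = 2 * Real.pi * S.re := by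
  have hne : ∀ φ : ℝ, ((1 - a * Real.sin φ : ℝ) : ℂ) + b * I ≠ 0 := fun φ h0 => by
    have := congrArg im h0
    simp at this
    exact hb.ne' this
  have h : ∀ φ : ℝ, b * (b ^ 2 + 1 + a ^ 2 - 2 * a * Real.sin φ) /
      (b ^ 2 + (1 - a * Real.sin φ) ^ 2) =
      -- With `A = a² + b² - 1` the numerator is `b (A + 2 x)`, and `S² = A - 2 b i`.
      (-S ^ 2 * (((1 - a * Real.sin φ : ℝ) : ℂ) + b * I)⁻¹).im := by
    intro φ
    have e : ((a : ℂ) ^ 2 + ((b : ℂ) - I) ^ 2) = ((a ^ 2 + b ^ 2 - 1 : ℝ) : ℂ) +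
      ((-2 * b : ℝ) : ℂ) * I := by
      push_cast
      linear_combination I_sq
    rw [hS, e]
    have hx : b ^ 2 + 1 + a ^ 2 - 2 * a * Real.sin φ =
        a ^ 2 + b ^ 2 - 1 + 2 * (1 - a * Real.sin φ) := by ring
    rw [hx]
    generalize 1 - a * Real.sin φ = x at *
    have hN : normSq ((x : ℂ) + b * I) = b ^ 2 + x ^ 2 := by
      simp [normSq_apply]
      ring
    rw [mul_im, inv_re, inv_im, hN]
    generalize a ^ 2 + b ^ 2 - 1 = A
    simp
    ring
  simp only [h]
  rw [intervalIntegral_im, intervalIntegral.integral_const_mul, integral_inv_sub_sin hb hS hre]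
  · have hS0 : S ≠ 0 := fun h => by simp [h] at hre
    rw [show -S ^ 2 * (2 * Real.pi / (I * S)) = ((2 * Real.pi : ℝ) : ℂ) * (I * S) by
      push_cast
      field_simp
      rw [I_sq], im_ofReal_mul, I_mul_im]
  · exact continuous_const.mul (Continuous.inv₀ (by fun_prop) hne)

end

/-! ### Differential geometry of the two patches -/

theorem hasDerivAt_vec3 {f g h : ℝ → ℝ} {f' g' h' t : ℝ} (hf : HasDerivAt f f' t)
    (hg : HasDerivAt g g' t) (hh : HasDerivAt h h' t) :
    HasDerivAt (fun t => (!₂[f t, g t, h t] : E3)) !₂[f', g', h'] t := by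
  have : HasDerivAt (fun t => ![f t, g t, h t]) ![f', g', h'] t := by
    rw [hasDerivAt_pi]
    intro i
    fin_cases i
    exacts [hf, hg, hh]
  exact (PiLp.continuousLinearEquiv 2 ℝ (fun _ : Fin 3 => ℝ)).symm.hasFDerivAt.comp_hasDerivAt t
    this

theorem cross_vec3 (x y z x' y' z' : ℝ) :
    cross !₂[x, y, z] !₂[x', y', z'] = !₂[y * z' - z * y', z * x' - x * z', x * y' - y * x'] := by
  simp [cross, cross_apply]

theorem norm_vec3 (x y z : ℝ) : ‖(!₂[x, y, z] : E3)‖ = Real.sqrt (x ^ 2 + y ^ 2 + z ^ 2) := by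
  simp [EuclideanSpace.norm_eq, Fin.sum_univ_three]

/-- The patch `(v, u, 0)`, whose restriction to the unit disk parametrizes the base. -/
noncomputable def basePatch (p : ℝ × ℝ) : E3 := !₂[p.2, p.1, 0]

theorem du_basePatch (p : ℝ × ℝ) : du basePatch p = !₂[0, 1, 0] :=
  (hasDerivAt_vec3 (hasDerivAt_const p.1 p.2) (hasDerivAt_id p.1) (hasDerivAt_const p.1 0)).deriv

theorem dv_basePatch (p : ℝ × ℝ) : dv basePatch p = !₂[1, 0, 0] :=
  (hasDerivAt_vec3 (hasDerivAt_id p.2) (hasDerivAt_const p.2 p.1) (hasDerivAt_const p.2 0)).deriv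

/-- The swap of the two parameters in `basePatch` serves to make this normal point downwards, out of
the cone. -/
theorem cross_basePatch (p : ℝ × ℝ) :
    cross (du basePatch p) (dv basePatch p) = !₂[0, 0, -1] := by
  rw [du_basePatch, dv_basePatch, cross_vec3]
  simp

theorem unitNormal_basePatch : unitNormal basePatch = fun _ => !₂[0, 0, -1] := by
  ext1 p
  rw [unitNormal, cross_basePatch, norm_vec3]
  simp

theorem meanCurvature_basePatch (p : ℝ × ℝ) : meanCurvature basePatch p = 0 := by
  simp [meanCurvature, coeffL, coeffM, coeffN, unitNormal_basePatch, du, dv]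

/-- The lateral surface of the oblique cone, parametrized by the angle on the base circle and the
position on the segment from the base circle to the apex. -/
noncomputable def lateralPatch (a b : ℝ) (p : ℝ × ℝ) : E3 :=
  !₂[(1 - p.2) * Real.cos p.1, (1 - p.2) * Real.sin p.1 + p.2 * a, p.2 * b]

section

variable (a b : ℝ) (p : ℝ × ℝ)

theorem du_lateralPatch : du (lateralPatch a b) p =
    !₂[(1 - p.2) * -Real.sin p.1, (1 - p.2) * Real.cos p.1, 0] :=
  (hasDerivAt_vec3 ((Real.hasDerivAt_cos p.1).const_mul (1 - p.2))
    (((Real.hasDerivAt_sin p.1).const_mul (1 - p.2)).add_const (p.2 * a))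
    (hasDerivAt_const p.1 (p.2 * b))).deriv

theorem dv_lateralPatch : dv (lateralPatch a b) p =
    !₂[-Real.cos p.1, -Real.sin p.1 + a, b] := by
  have h := hasDerivAt_id p.2
  simpa [dv, lateralPatch] using (hasDerivAt_vec3 ((h.const_sub 1).mul_const (Real.cos p.1))
    ((((h.const_sub 1).mul_const (Real.sin p.1))).add (h.mul_const a)) (h.mul_const b)).deriv

theorem cross_lateralPatch : cross (du (lateralPatch a b) p) (dv (lateralPatch a b) p) =
    (1 - p.2) • !₂[b * Real.cos p.1, b * Real.sin p.1, 1 - a * Real.sin p.1] := by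
  rw [du_lateralPatch, dv_lateralPatch, cross_vec3]
  ext i
  have := Real.sin_sq_add_cos_sq p.1
  fin_cases i <;> simp
  · ring
  · ring
  · linear_combination (1 - p.2) * this

theorem norm_conormal : ‖(!₂[b * Real.cos p.1, b * Real.sin p.1, 1 - a * Real.sin p.1] : E3)‖ =
    Real.sqrt (b ^ 2 + (1 - a * Real.sin p.1) ^ 2) := by
  rw [norm_vec3]
  congr 1
  linear_combination b ^ 2 * Real.sin_sq_add_cos_sq p.1

end

section

variable {a b : ℝ}

theorem conormal_sq_pos (hb : 0 < b) (u : ℝ) : 0 < b ^ 2 + (1 - a * Real.sin u) ^ 2 := by positivity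

theorem unitNormal_lateralPatch (hb : 0 < b) {p : ℝ × ℝ} (hp : p.2 < 1) :
    unitNormal (lateralPatch a b) p = (Real.sqrt (b ^ 2 + (1 - a * Real.sin p.1) ^ 2))⁻¹ •
      !₂[b * Real.cos p.1, b * Real.sin p.1, 1 - a * Real.sin p.1] := by
  have h1 : 0 < 1 - p.2 := by linarith
  have h2 := Real.sqrt_pos.2 (conormal_sq_pos (a := a) hb p.1)
  rw [unitNormal, cross_lateralPatch, norm_smul, norm_conormal, smul_smul, Real.norm_of_nonneg h1.le]
  congr 1
  field_simp

/-- The surface is developable: along a ruling the conormal changes only by the positive factor `1 -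
p.2`, which normalization removes. -/
theorem dv_unitNormal_lateralPatch (hb : 0 < b) {p : ℝ × ℝ} (hp : p.2 < 1) :
    dv (unitNormal (lateralPatch a b)) p = 0 := by
  rw [dv, Filter.EventuallyEq.deriv_eq (f := fun _ => unitNormal (lateralPatch a b) p)]
  · simp
  · filter_upwards [Iio_mem_nhds hp] with t ht
    rw [unitNormal_lateralPatch hb hp, unitNormal_lateralPatch hb (p := (p.1, t)) ht]

/-- The coefficient `c`, the derivative of the normalizing factor, may stay unspecified: it
multiplies a normal vector, which is orthogonal to both tangent vectors. -/
theorem exists_du_unitNormal_lateralPatch (hb : 0 < b) {p : ℝ × ℝ} (hp : p.2 < 1) :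
    ∃ c : ℝ, du (unitNormal (lateralPatch a b)) p =
      c • !₂[b * Real.cos p.1, b * Real.sin p.1, 1 - a * Real.sin p.1] +
      (Real.sqrt (b ^ 2 + (1 - a * Real.sin p.1) ^ 2))⁻¹ •
        !₂[b * -Real.sin p.1, b * Real.cos p.1, -(a * Real.cos p.1)] := by
  have h : (fun s => unitNormal (lateralPatch a b) (s, p.2)) = fun s =>
      (Real.sqrt (b ^ 2 + (1 - a * Real.sin s) ^ 2))⁻¹ •
        (!₂[b * Real.cos s, b * Real.sin s, 1 - a * Real.sin s] : E3) := by
    ext1 s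
    exact unitNormal_lateralPatch hb (p := (s, p.2)) hp
  have hW := conormal_sq_pos (a := a) hb p.1
  have hq : DifferentiableAt ℝ (fun s => (Real.sqrt (b ^ 2 + (1 - a * Real.sin s) ^ 2))⁻¹) p.1 := by
    refine DifferentiableAt.inv (DifferentiableAt.sqrt (by fun_prop) hW.ne') ?_
    exact (Real.sqrt_pos.2 hW).ne'
  have hn := hasDerivAt_vec3 ((Real.hasDerivAt_cos p.1).const_mul b) ((Real.hasDerivAt_sin p.1).const_mul b)
    (((Real.hasDerivAt_sin p.1).const_mul a).const_sub 1)
  refine ⟨deriv (fun s => (Real.sqrt (b ^ 2 + (1 - a * Real.sin s) ^ 2))⁻¹) p.1, ?_⟩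
  rw [du, h, (hq.hasDerivAt.fun_smul hn).deriv, add_comm]

/-- As `M = N = 0`, only `G L` remains in the numerator. The powers of `1 - p.2` and the square root
of `b² + x²` then cancel against the area density, so the result is constant along rulings. -/
theorem meanCurvature_mul_areaDensity_lateralPatch (hb : 0 < b) {p : ℝ × ℝ} (hp : p.2 < 1) :
    meanCurvature (lateralPatch a b) p * areaDensity (lateralPatch a b) p =
      b * (b ^ 2 + 1 + a ^ 2 - 2 * a * Real.sin p.1) /
        (b ^ 2 + (1 - a * Real.sin p.1) ^ 2) / 2 := by
  obtain ⟨c, hc⟩ := exists_du_unitNormal_lateralPatch (a := a) hb hp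
  have hW := conormal_sq_pos (a := a) hb p.1
  have h1 : 0 < 1 - p.2 := by linarith
  have hsc := Real.sin_sq_add_cos_sq p.1
  have hE : coeffE (lateralPatch a b) p = (1 - p.2) ^ 2 := by
    rw [coeffE, du_lateralPatch, inner_E3]
    simp
    linear_combination (1 - p.2) ^ 2 * hsc
  have hF : coeffF (lateralPatch a b) p = (1 - p.2) * (a * Real.cos p.1) := by
    rw [coeffF, du_lateralPatch, dv_lateralPatch, inner_E3]
    simp
    ring
  have hG : coeffG (lateralPatch a b) p = b ^ 2 + 1 + a ^ 2 - 2 * a * Real.sin p.1 := by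
    rw [coeffG, dv_lateralPatch, inner_E3]
    simp
    linear_combination hsc
  have hN : coeffN (lateralPatch a b) p = 0 := by
    rw [coeffN, dv_unitNormal_lateralPatch hb hp, inner_zero_right]
  have hM : coeffM (lateralPatch a b) p = 0 := by
    rw [coeffM, dv_unitNormal_lateralPatch hb hp, inner_zero_right, hc, dv_lateralPatch, inner_E3]
    simp
    linear_combination -c * b * hsc
  have hL : coeffL (lateralPatch a b) p =
      (1 - p.2) * b * (Real.sqrt (b ^ 2 + (1 - a * Real.sin p.1) ^ 2))⁻¹ := by
    rw [coeffL, hc, du_lateralPatch, inner_E3]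
    simp
    linear_combination (1 - p.2) * b * (Real.sqrt (b ^ 2 + (1 - a * Real.sin p.1) ^ 2))⁻¹ * hsc
  have hD : (1 - p.2) ^ 2 * (b ^ 2 + 1 + a ^ 2 - 2 * a * Real.sin p.1) -
      ((1 - p.2) * (a * Real.cos p.1)) ^ 2 =
      (1 - p.2) ^ 2 * (b ^ 2 + (1 - a * Real.sin p.1) ^ 2) := by
    linear_combination -(1 - p.2) ^ 2 * a ^ 2 * hsc
  rw [meanCurvature, areaDensity, hE, hF, hG, hN, hM, hL, hD, Real.sqrt_mul (by positivity),
    Real.sqrt_sq h1.le]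
  have hs := Real.sqrt_pos.2 hW
  generalize b ^ 2 + (1 - a * Real.sin p.1) ^ 2 = W at *
  field_simp
  ring

/-- The tangent plane along the ruling at angle `u` supports the cone, by Cauchy–Schwarz in the base
disk; the apex lies on all these planes. -/
theorem inner_conormal_le (hb : 0 < b) {q : E3} (hq : q ∈ cone a b) (u : ℝ) :
    ⟪q, !₂[b * Real.cos u, b * Real.sin u, 1 - a * Real.sin u]⟫ ≤ b := by
  obtain ⟨s, ⟨hs, hs1⟩, x, y, hxy, rfl⟩ := mem_cone_iff_exists.1 hq
  rw [inner_E3]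
  simp only [Matrix.cons_val]
  have h : x * Real.cos u + y * Real.sin u ≤ 1 := by
    nlinarith [sq_nonneg (x - Real.cos u), sq_nonneg (y - Real.sin u), Real.sin_sq_add_cos_sq u]
  nlinarith [mul_le_mul_of_nonneg_left h (mul_nonneg hb.le (sub_nonneg.2 hs1))]

theorem inner_lateralPatch (p : ℝ × ℝ) :
    ⟪lateralPatch a b p, !₂[b * Real.cos p.1, b * Real.sin p.1, 1 - a * Real.sin p.1]⟫ = b := by
  rw [lateralPatch, inner_E3]
  simp only [Matrix.cons_val]
  linear_combination b * (1 - p.2) * Real.sin_sq_add_cos_sq p.1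

end

/-! ### The boundary parametrization and the integrated mean curvature -/

theorem lateralPatch_mem_cone {a b : ℝ} {p : ℝ × ℝ} (hp : p.2 ∈ Set.Icc (0 : ℝ) 1) :
    lateralPatch a b p ∈ cone a b :=
  mem_cone_iff_exists.2 ⟨p.2, hp, _, _, (Real.cos_sq_add_sin_sq p.1).le, rfl⟩

theorem basePatch_mem_cone {a b : ℝ} {p : ℝ × ℝ} (hp : p.1 ^ 2 + p.2 ^ 2 ≤ 1) :
    basePatch p ∈ cone a b :=
  mem_cone_iff_exists.2 ⟨0, by simp, p.2, p.1, by linarith, by simp [basePatch]⟩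

/-- A `C¹` curve has Hausdorff dimension at most `1`. -/
theorem hausdorffMeasure_two_range {f : ℝ → E3} (hf : ContDiff ℝ 1 f) :
    μH[2] (Set.range f) = 0 := by
  have h := hf.dimH_range_le
  have h2 : dimH (Set.range f) < ((2 : NNReal) : ENNReal) :=
    h.trans_lt (by simp)
  simpa using hausdorffMeasure_of_dimH_lt h2

theorem exists_angle {x y : ℝ} (h : x ^ 2 + y ^ 2 = 1) :
    ∃ u ∈ Set.Ioc (-Real.pi) Real.pi, x = Real.cos u ∧ y = Real.sin u := by
  have hn : ‖(⟨x, y⟩ : ℂ)‖ = 1 := by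
    rw [Complex.norm_def, Complex.normSq_mk, ← pow_two, ← pow_two, h, Real.sqrt_one]
  have h0 : (⟨x, y⟩ : ℂ) ≠ 0 := fun h => by simp [h] at hn
  refine ⟨Complex.arg ⟨x, y⟩, Complex.arg_mem_Ioc _, ?_, ?_⟩
  · rw [Complex.cos_arg h0, hn, div_one]
  · rw [Complex.sin_arg, hn, div_one]

theorem injOn_cos_sin {u v : ℝ} (hu : u ∈ Set.Ioo (-Real.pi) Real.pi)
    (hv : v ∈ Set.Ioo (-Real.pi) Real.pi) (hc : Real.cos u = Real.cos v)
    (hs : Real.sin u = Real.sin v) : u = v := by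
  have h1 := Complex.arg_cos_add_sin_mul_I ⟨hu.1, hu.2.le⟩
  have h2 := Complex.arg_cos_add_sin_mul_I ⟨hv.1, hv.2.le⟩
  rw [← h1, ← h2, ← Complex.ofReal_cos, ← Complex.ofReal_sin, hc, hs, Complex.ofReal_cos,
    Complex.ofReal_sin]

/-- The open patches miss the base circle and the seam: the ruling at angle `π`, which also contains
the apex. Both lie on smooth curves. -/
theorem frontier_cone_sdiff_subset {a b : ℝ} (hb : 0 < b) :
    frontier (cone a b) \ (lateralPatch a b '' (Set.Ioo (-Real.pi) Real.pi ×ˢ Set.Ioo 0 1) ∪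
      basePatch '' {p | p.1 ^ 2 + p.2 ^ 2 < 1}) ⊆
    Set.range (fun t : ℝ => (!₂[Real.cos t, Real.sin t, 0] : E3)) ∪
      Set.range (fun t : ℝ => (!₂[-(1 - t), t * a, t * b] : E3)) := by
  rintro p ⟨hp, hn⟩
  have circ : ∀ {x y : ℝ}, x ^ 2 + y ^ 2 = 1 →
      !₂[x, y, 0] ∈ Set.range (fun t : ℝ => (!₂[Real.cos t, Real.sin t, 0] : E3)) := by
    intro x y h
    obtain ⟨u, -, rfl, rfl⟩ := exists_angle h
    exact ⟨u, rfl⟩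
  rcases exists_of_mem_frontier_cone hb hp with ⟨x, y, hxy, rfl⟩ | ⟨s, ⟨hs, hs1⟩, x, y, hxy, rfl⟩
  · rcases hxy.eq_or_lt with h | h
    · exact Or.inl (circ h)
    · exact absurd (Or.inr ⟨(y, x), show y ^ 2 + x ^ 2 < 1 by linarith, rfl⟩) hn
  rcases hs.eq_or_lt with rfl | hs0
  · left
    simpa using circ hxy
  rcases hs1.eq_or_lt with rfl | hs1
  · right
    exact ⟨1, by simp⟩
  obtain ⟨u, ⟨hu, hu'⟩, rfl, rfl⟩ := exists_angle hxy
  rcases hu'.eq_or_lt with rfl | hu'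
  · right
    exact ⟨s, by simp⟩
  · exact absurd (Or.inl ⟨(u, s), ⟨⟨hu, hu'⟩, hs0, hs1⟩, rfl⟩) hn

theorem isBoundaryParametrization_cone {a b : ℝ} (hb : 0 < b) :
    IsBoundaryParametrization (cone a b) ![lateralPatch a b, basePatch]
      ![Set.Ioo (-Real.pi) Real.pi ×ˢ Set.Ioo 0 1, {p | p.1 ^ 2 + p.2 ^ 2 < 1}] := by
  have nondeg : ∀ p ∈ Set.Ioo (-Real.pi) Real.pi ×ˢ Set.Ioo (0 : ℝ) 1,
      cross (du (lateralPatch a b) p) (dv (lateralPatch a b) p) ≠ 0 := by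
    rintro p ⟨-, -, hp⟩
    have h1 : 0 < 1 - p.2 := sub_pos.2 hp
    have h2 := Real.sqrt_pos.2 (conormal_sq_pos (a := a) hb p.1)
    rw [cross_lateralPatch, ← norm_pos_iff, norm_smul, norm_conormal, Real.norm_of_nonneg h1.le]
    positivity
  have nondeg' : ∀ p, cross (du basePatch p) (dv basePatch p) ≠ 0 := by
    intro p
    rw [cross_basePatch, ← norm_pos_iff, norm_vec3]
    simp
  have out : ∀ p ∈ Set.Ioo (-Real.pi) Real.pi ×ˢ Set.Ioo (0 : ℝ) 1, ∀ q ∈ cone a b,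
      ⟪q - lateralPatch a b p, unitNormal (lateralPatch a b) p⟫ ≤ 0 := by
    rintro p ⟨-, -, hp⟩ q hq
    rw [unitNormal_lateralPatch hb hp, inner_smul_right, inner_sub_left, inner_lateralPatch]
    exact mul_nonpos_of_nonneg_of_nonpos (by positivity)
      (sub_nonpos.2 (inner_conormal_le hb hq p.1))
  have out' : ∀ p : ℝ × ℝ, ∀ q ∈ cone a b,
      ⟪q - basePatch p, unitNormal basePatch p⟫ ≤ 0 := by
    intro p q hq
    rw [unitNormal_basePatch, inner_E3]
    simpa [basePatch] using ((mem_cone_iff hb).1 hq).1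
  have normal_ne : ∀ {X : ℝ × ℝ → E3} {p}, cross (du X p) (dv X p) ≠ 0 → unitNormal X p ≠ 0 :=
    fun h => smul_ne_zero (inv_ne_zero (norm_ne_zero_iff.2 h)) h
  have disj : Disjoint (lateralPatch a b '' (Set.Ioo (-Real.pi) Real.pi ×ˢ Set.Ioo 0 1))
      (basePatch '' {p | p.1 ^ 2 + p.2 ^ 2 < 1}) := by
    rw [Set.disjoint_left]
    rintro _ ⟨p, ⟨-, hp, -⟩, rfl⟩ ⟨q, -, hq⟩
    have := congrArg (fun x : E3 => x 2) hq
    simp [basePatch, lateralPatch] at this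
    rcases this with h | h
    · exact hp.ne' h
    · exact hb.ne' h
  refine ⟨?_, ?_, ?_, ?_, ?_, ?_, ?_, ?_⟩
  · rw [Fin.forall_fin_two]
    exact ⟨isOpen_Ioo.prod isOpen_Ioo, isOpen_lt (by fun_prop) (by fun_prop)⟩
  · rw [Fin.forall_fin_two]
    refine ⟨ContDiff.contDiffOn (contDiff_euclidean.2 fun i => ?_),
      ContDiff.contDiffOn (contDiff_euclidean.2 fun i => ?_)⟩
    · fin_cases i <;> simp [lateralPatch] <;> fun_prop
    · fin_cases i <;> simp [basePatch] <;> fun_prop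
  · rw [Fin.forall_fin_two]
    constructor
    · rintro ⟨u, s⟩ ⟨hu, hs⟩ ⟨v, t⟩ ⟨hv, ht⟩ h
      have e0 := congrArg (fun x : E3 => x 0) h
      have e1 := congrArg (fun x : E3 => x 1) h
      have e2 := congrArg (fun x : E3 => x 2) h
      simp only [Matrix.cons_val, lateralPatch] at e0 e1 e2
      obtain rfl : s = t := mul_right_cancel₀ hb.ne' e2
      have hs1 : 1 - s ≠ 0 := (sub_pos.2 hs.2).ne'
      exact Prod.ext (injOn_cos_sin hu hv (mul_left_cancel₀ hs1 e0)
        (mul_left_cancel₀ hs1 (add_right_cancel e1))) rfl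
    · rintro ⟨u, s⟩ - ⟨v, t⟩ - h
      have e0 := congrArg (fun x : E3 => x 0) h
      have e1 := congrArg (fun x : E3 => x 1) h
      simp only [Matrix.cons_val, basePatch] at e0 e1
      rw [e0, e1]
  · rw [Fin.forall_fin_two]
    exact ⟨nondeg, fun p _ => nondeg' p⟩
  · simp only [Fin.forall_fin_two]
    exact ⟨⟨fun h => absurd rfl h, fun _ => disj⟩, fun _ => disj.symm, fun h => absurd rfl h⟩
  · rw [Fin.forall_fin_two]
    constructor
    -- The outward normal condition also shows that the patch lies in the frontier.
    · rintro _ ⟨p, hp, rfl⟩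
      exact mem_frontier_of_forall_inner_le (lateralPatch_mem_cone ⟨hp.2.1.le, hp.2.2.le⟩)
        (normal_ne (nondeg p hp)) (out p hp)
    · rintro _ ⟨p, hp, rfl⟩
      exact mem_frontier_of_forall_inner_le (basePatch_mem_cone (le_of_lt hp))
        (normal_ne (nondeg' p)) (out' p)
  · rw [Fin.forall_fin_two]
    exact ⟨out, fun p _ => out' p⟩
  · have hU : (⋃ i, (![lateralPatch a b, basePatch] i) ''
        (![Set.Ioo (-Real.pi) Real.pi ×ˢ Set.Ioo 0 1, {p | p.1 ^ 2 + p.2 ^ 2 < 1}] i)) =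
        lateralPatch a b '' (Set.Ioo (-Real.pi) Real.pi ×ˢ Set.Ioo 0 1) ∪
          basePatch '' {p | p.1 ^ 2 + p.2 ^ 2 < 1} := by
      ext x
      simp only [Set.mem_iUnion, Fin.exists_fin_two, Set.mem_union]
      rfl
    rw [hU]
    refine measure_mono_null (frontier_cone_sdiff_subset hb) (measure_union_null ?_ ?_)
    · refine hausdorffMeasure_two_range (contDiff_euclidean.2 fun i => ?_)
      fin_cases i <;> simp <;> fun_prop
    · refine hausdorffMeasure_two_range (contDiff_euclidean.2 fun i => ?_)
      fin_cases i <;> simp <;> fun_prop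

theorem hasIntegratedMeanCurvature_cone {a b : ℝ} (hb : 0 < b) :
    HasIntegratedMeanCurvature (cone a b)
      ((∫ φ in -Real.pi..Real.pi, b * (b ^ 2 + 1 + a ^ 2 - 2 * a * Real.sin φ) /
        (b ^ 2 + (1 - a * Real.sin φ) ^ 2)) / 2) := by
  set g : ℝ → ℝ := fun φ => b * (b ^ 2 + 1 + a ^ 2 - 2 * a * Real.sin φ) /
    (b ^ 2 + (1 - a * Real.sin φ) ^ 2) with hg
  have hgc : Continuous g :=
    Continuous.div (by fun_prop) (by fun_prop) fun φ => (conormal_sq_pos hb φ).ne'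
  have hm : MeasurableSet (Set.Ioo (-Real.pi) Real.pi ×ˢ Set.Ioo (0 : ℝ) 1) :=
    measurableSet_Ioo.prod measurableSet_Ioo
  -- The trivial factor `1` puts the integrand in product form for Fubini.
  have heq : Set.EqOn (fun p => meanCurvature (lateralPatch a b) p * areaDensity (lateralPatch a b) p)
      (fun p => g p.1 / 2 * 1) (Set.Ioo (-Real.pi) Real.pi ×ˢ Set.Ioo 0 1) := by
    rintro p ⟨-, -, hp⟩
    simp only [hg, mul_one]
    exact meanCurvature_mul_areaDensity_lateralPatch hb hp
  have h0 : (fun p => meanCurvature basePatch p * areaDensity basePatch p) = fun _ => 0 := by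
    ext p
    rw [meanCurvature_basePatch, zero_mul]
  refine ⟨2, _, _, isBoundaryParametrization_cone hb, ?_, ?_⟩
  · rw [Fin.forall_fin_two]
    constructor
    · refine IntegrableOn.congr_fun ?_ heq.symm hm
      refine IntegrableOn.mono_set (t := Set.Icc (-Real.pi) Real.pi ×ˢ Set.Icc (0 : ℝ) 1) ?_
        (Set.prod_mono Set.Ioo_subset_Icc_self Set.Ioo_subset_Icc_self)
      exact ContinuousOn.integrableOn_compact (isCompact_Icc.prod isCompact_Icc) (by fun_prop)
    · simp only [Matrix.cons_val_one, Matrix.cons_val_zero, h0]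
      exact integrableOn_zero
  · rw [Fin.sum_univ_two]
    simp only [Matrix.cons_val_one, Matrix.cons_val_zero, h0, integral_zero, add_zero]
    rw [setIntegral_congr_fun hm heq, Measure.volume_eq_prod, setIntegral_prod_mul (fun x => g x / 2) fun _ => 1,
      ← integral_Ioc_eq_integral_Ioo, ← intervalIntegral.integral_of_le (by linarith [Real.pi_pos]),
      intervalIntegral.integral_div]
    simp

/-! ### Spherical coordinates and homogeneous functions -/

theorem measurePreserving_coords :
    MeasurePreserving (fun x : E3 => ((x 2, (x 0, x 1)) : ℝ × ℝ × ℝ)) := by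
  have h1 := PiLp.volume_preserving_ofLp (Fin 3)
  have h2 := volume_preserving_piFinSuccAbove (fun _ : Fin 3 => ℝ) 2
  have h3 := (MeasurePreserving.id (volume : Measure ℝ)).prod (volume_preserving_finTwoArrow ℝ)
  exact h3.comp (h2.comp h1)

theorem measurable_vec3 {α : Type*} [MeasurableSpace α] {f g h : α → ℝ} (hf : Measurable f)
    (hg : Measurable g) (hh : Measurable h) :
    Measurable fun t => (!₂[f t, g t, h t] : E3) := by
  refine (PiLp.continuousLinearEquiv 2 ℝ (fun _ : Fin 3 => ℝ)).symm.continuous.measurable.comp ?_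
  refine measurable_pi_iff.2 fun i => ?_
  fin_cases i
  exacts [hf, hg, hh]

theorem lintegral_E3 {F : E3 → ENNReal} (hF : Measurable F) :
    ∫⁻ x, F x = ∫⁻ q : ℝ × ℝ × ℝ, F !₂[q.2.1, q.2.2, q.1] := by
  have hG : Measurable fun q : ℝ × ℝ × ℝ => F !₂[q.2.1, q.2.2, q.1] :=
    hF.comp (measurable_vec3 (by fun_prop) (by fun_prop) (by fun_prop))
  rw [← measurePreserving_coords.lintegral_comp hG]
  congr 1
  ext x
  congr 1
  ext i
  fin_cases i <;> rfl

/-- Integration in spherical coordinates, with longitude `φ` and latitude `ψ`. -/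
theorem lintegral_spherical {F : E3 → ENNReal} (hF : Measurable F) :
    ∫⁻ x, F x = ∫⁻ φ in Set.Ioo (-Real.pi) Real.pi,
      ∫⁻ q in Set.Ioi (0 : ℝ) ×ˢ Set.Ioo (-(Real.pi / 2)) (Real.pi / 2),
        ENNReal.ofReal (q.1 ^ 2 * Real.cos q.2) *
          F !₂[q.1 * Real.cos q.2 * Real.cos φ, q.1 * Real.cos q.2 * Real.sin φ,
            q.1 * Real.sin q.2] := by
  -- Polar coordinates are used twice: in the horizontal plane, giving `(ρ, φ)`, then in the
  -- half-plane of `(ρ, z)`, giving `(R, ψ)`. The Jacobians `ρ = R cos ψ` and `R` multiply to `R²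
  -- cos ψ`.
  set H : ℝ → ℝ → ℝ → ENNReal := fun z ρ φ =>
    ENNReal.ofReal ρ * F !₂[ρ * Real.cos φ, ρ * Real.sin φ, z] with hH
  have hHm : Measurable fun x : ℝ × ℝ × ℝ => H x.1 x.2.1 x.2.2 := by
    refine Measurable.mul (by fun_prop) (hF.comp (measurable_vec3 ?_ ?_ ?_)) <;> fun_prop
  have hG : Measurable fun q : ℝ × ℝ × ℝ => F !₂[q.2.1, q.2.2, q.1] :=
    hF.comp (measurable_vec3 (by fun_prop) (by fun_prop) (by fun_prop))
  calc ∫⁻ x, F x = ∫⁻ z : ℝ, ∫⁻ v : ℝ × ℝ, F !₂[v.1, v.2, z] := by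
        rw [lintegral_E3 hF, Measure.volume_eq_prod, lintegral_prod _ hG.aemeasurable]
    _ = ∫⁻ z : ℝ, ∫⁻ φ in Set.Ioo (-Real.pi) Real.pi, ∫⁻ ρ in Set.Ioi 0, H z ρ φ := by
        congr 1
        ext1 z
        rw [← lintegral_comp_polarCoord_symm, Measure.volume_eq_prod, polarCoord_target,
          ← Measure.prod_restrict, lintegral_prod_symm _ ?_]
        · rfl
        · exact (hHm.comp (f := fun p : ℝ × ℝ => (z, p)) (by fun_prop)).aemeasurable
    _ = ∫⁻ φ in Set.Ioo (-Real.pi) Real.pi, ∫⁻ z : ℝ, ∫⁻ ρ in Set.Ioi 0, H z ρ φ := by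
        rw [lintegral_lintegral_swap]
        refine Measurable.aemeasurable (Measurable.lintegral_prod_right
          (f := fun (p : (ℝ × ℝ)) (ρ : ℝ) => H p.1 ρ p.2) ?_)
        exact hHm.comp (f := fun p : (ℝ × ℝ) × ℝ => (p.1.1, p.2, p.1.2)) (by fun_prop)
    _ = _ := by
        congr 1
        ext1 φ
        -- Extension by zero to `ρ ≤ 0` makes planar polar coordinates applicable; the indicator
        -- later cuts the angle down to `(-π/2, π/2)`, where `cos ψ > 0`.
        have hm : Measurable fun q : ℝ × ℝ => (Set.Ioi 0).indicator (fun ρ => H q.2 ρ φ) q.1 := by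
          have h0 : Measurable fun q : ℝ × ℝ => H q.2 q.1 φ :=
            hHm.comp (f := fun q : ℝ × ℝ => (q.2, q.1, φ)) (by fun_prop)
          exact h0.indicator (measurable_fst measurableSet_Ioi)
        have h1 : ∫⁻ z : ℝ, ∫⁻ ρ in Set.Ioi 0, H z ρ φ =
            ∫⁻ q : ℝ × ℝ, (Set.Ioi 0).indicator (fun ρ => H q.2 ρ φ) q.1 := by
          rw [Measure.volume_eq_prod, lintegral_prod_symm _ hm.aemeasurable]
          congr 1
          ext1 z
          exact (lintegral_indicator measurableSet_Ioi _).symm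
        rw [h1, ← lintegral_comp_polarCoord_symm,
          ← lintegral_indicator polarCoord.open_target.measurableSet,
          ← lintegral_indicator (measurableSet_Ioi.prod measurableSet_Ioo)]
        congr 1
        ext1 ⟨R, ψ⟩
        have hpi := Real.pi_pos
        by_cases hR : 0 < R
        swap
        · rw [Set.indicator_of_notMem, Set.indicator_of_notMem]
          · exact fun h => hR h.1
          · exact fun h => hR h.1
        by_cases hψ : ψ ∈ Set.Ioo (-(Real.pi / 2)) (Real.pi / 2)
        · have hc : 0 < Real.cos ψ := Real.cos_pos_of_mem_Ioo hψ
          rw [Set.indicator_of_mem (a := (R, ψ)), Set.indicator_of_mem (a := (R, ψ)),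
            polarCoord_symm_apply, Set.indicator_of_mem]
          · simp only [hH, smul_eq_mul]
            rw [← mul_assoc, ← ENNReal.ofReal_mul hR.le]
            ring_nf
          · exact mul_pos hR hc
          · exact ⟨hR, hψ⟩
          · exact ⟨hR, by linarith [hψ.1], by linarith [hψ.2]⟩
        · rw [Set.indicator_of_notMem (s := Set.Ioi 0 ×ˢ _) fun h => hψ h.2]
          by_cases hψ' : ψ ∈ Set.Ioo (-Real.pi) Real.pi
          · rw [Set.indicator_of_mem (s := polarCoord.target) (a := (R, ψ)) ⟨hR, hψ'⟩, polarCoord_symm_apply,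
              Set.indicator_of_notMem, smul_zero]
            intro h
            have hc : 0 < Real.cos ψ := (mul_pos_iff_of_pos_left hR).1 h
            refine hψ ⟨?_, ?_⟩
            · by_contra! hle
              have := Real.cos_nonpos_of_pi_div_two_le_of_le (x := -ψ) (by linarith)
                (by linarith [hψ'.1])
              rw [Real.cos_neg] at this
              linarith
            · by_contra! hle
              have := Real.cos_nonpos_of_pi_div_two_le_of_le hle (by linarith [hψ'.2])
              linarith
          · rw [Set.indicator_of_notMem (s := polarCoord.target) fun h => hψ' h.2]

theorem lintegral_cube : ∫⁻ r in Set.Ioo (0 : ℝ) 1, ENNReal.ofReal (r ^ 3) = 4⁻¹ := by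
  rw [← ofReal_integral_eq_lintegral_ofReal, ← integral_Ioc_eq_integral_Ioo,
    ← intervalIntegral.integral_of_le zero_le_one, integral_pow]
  · norm_num
    rw [one_div, ENNReal.ofReal_inv_of_pos (by norm_num)]
    norm_num
  · exact ((continuous_pow 3).integrableOn_Icc).mono_set Set.Ioo_subset_Icc_self
  · filter_upwards [ae_restrict_mem measurableSet_Ioo] with r hr
    exact pow_nonneg hr.1.le 3

/-- For a positively homogeneous function, integration over the unit ball reduces to integration
over the unit sphere. -/
theorem setLIntegral_ball_of_homogeneous {G : E3 → ENNReal} (hG : Measurable G)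
    (hom : ∀ r : ℝ, 0 < r → ∀ x, G (r • x) = ENNReal.ofReal r * G x) :
    ∫⁻ x in Metric.ball 0 1, G x =
      (∫⁻ w : Metric.sphere (0 : E3) 1, G w ∂(volume : Measure E3).toSphere) * 4⁻¹ := by
  -- The radial factor: one power of `r` from homogeneity, cut off at the unit ball. With the
  -- density `r²` it integrates to `∫₀¹ r³ = 1/4`.
  set u : ℝ → ENNReal := (Set.Iio 1).indicator fun r => ENNReal.ofReal r with hu
  have hum : Measurable u := Measurable.indicator (by fun_prop) measurableSet_Iio
  have h := (volume : Measure E3).measurePreserving_homeomorphUnitSphereProd.lintegral_comp_emb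
    (Homeomorph.measurableEmbedding _) fun p => G p.1 * u p.2
  rw [lintegral_prod_mul (f := fun w : Metric.sphere (0 : E3) 1 => G w)
    (g := fun r : Set.Ioi (0 : ℝ) => u r) (by fun_prop) (by fun_prop)] at h
  have hr : ∫⁻ r : Set.Ioi (0 : ℝ), u r ∂(Measure.volumeIoiPow (Module.finrank ℝ E3 - 1)) = 4⁻¹ := by
    rw [Measure.volumeIoiPow, lintegral_withDensity_eq_lintegral_mul _ (by fun_prop) (by fun_prop)]
    simp only [Pi.mul_apply]
    rw [lintegral_subtype_comap measurableSet_Ioi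
      fun r : ℝ => ENNReal.ofReal (r ^ (Module.finrank ℝ E3 - 1)) * u r, ← lintegral_cube,
      ← lintegral_indicator measurableSet_Ioi, ← lintegral_indicator measurableSet_Ioo]
    congr 1
    ext1 r
    by_cases h0 : 0 < r
    · by_cases h1 : r < 1
      · rw [Set.indicator_of_mem (show r ∈ Set.Ioi 0 from h0),
          Set.indicator_of_mem (show r ∈ Set.Ioo 0 1 from ⟨h0, h1⟩), hu,
          Set.indicator_of_mem (show r ∈ Set.Iio 1 from h1), ← ENNReal.ofReal_mul (by positivity)]
        simp [pow_succ]
      · rw [Set.indicator_of_mem (show r ∈ Set.Ioi 0 from h0),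
          Set.indicator_of_notMem (s := Set.Ioo 0 1) fun h => h1 h.2, hu,
          Set.indicator_of_notMem (s := Set.Iio 1) h1, mul_zero]
    · rw [Set.indicator_of_notMem (s := Set.Ioi 0) h0,
        Set.indicator_of_notMem (s := Set.Ioo 0 1) fun h => h0 h.1]
  rw [hr] at h
  rw [← h, ← lintegral_indicator measurableSet_ball]
  have h2 := lintegral_subtype_comap (μ := (volume : Measure E3))
    (measurableSet_singleton (0 : E3)).compl ((Metric.ball 0 1).indicator G)
  rw [restrict_compl_singleton] at h2
  rw [← h2]
  congr 1
  ext1 ⟨x, hx⟩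
  have hx0 : 0 < ‖x‖ := norm_pos_iff.2 hx
  have h3 := hom ‖x‖ hx0 (‖x‖⁻¹ • x)
  rw [smul_smul, mul_inv_cancel₀ hx0.ne', one_smul] at h3
  simp only [homeomorphUnitSphereProd_apply_fst_coe, homeomorphUnitSphereProd_apply_snd_coe]
  by_cases hb : ‖x‖ < 1
  · rw [Set.indicator_of_mem (by simpa using hb), hu, Set.indicator_of_mem (s := Set.Iio 1) hb, mul_comm, ← h3]
  · rw [Set.indicator_of_notMem (by simpa using hb), hu,
      Set.indicator_of_notMem (s := Set.Iio 1) hb, mul_zero]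

/-! ### The mean width as an integral of edge angles -/

theorem continuous_supportFun (a b : ℝ) : Continuous (supportFun a b) := by
  unfold supportFun
  fun_prop

theorem supportFun_nonneg (a b : ℝ) (w : E3) : 0 ≤ supportFun a b w :=
  (Real.sqrt_nonneg _).trans (le_max_left _ _)

theorem supportFun_smul (a b : ℝ) {r : ℝ} (hr : 0 ≤ r) (w : E3) :
    supportFun a b (r • w) = r * supportFun a b w := by
  simp only [supportFun, PiLp.smul_apply, smul_eq_mul]
  rw [mul_max_of_nonneg _ _ hr, show (r * w 0) ^ 2 + (r * w 1) ^ 2 = r ^ 2 * (w 0 ^ 2 + w 1 ^ 2) by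
    ring, Real.sqrt_mul (by positivity), Real.sqrt_sq hr]
  congr 1
  ring

theorem supportFun_spherical (a b φ : ℝ) {R ψ : ℝ} (hR : 0 ≤ R) (hψ : 0 ≤ Real.cos ψ) :
    supportFun a b !₂[R * Real.cos ψ * Real.cos φ, R * Real.cos ψ * Real.sin φ, R * Real.sin ψ] =
      R * max (Real.cos ψ) (a * Real.sin φ * Real.cos ψ + b * Real.sin ψ) := by
  simp only [supportFun, Matrix.cons_val]
  rw [mul_max_of_nonneg _ _ hR, show (R * Real.cos ψ * Real.cos φ) ^ 2 +
    (R * Real.cos ψ * Real.sin φ) ^ 2 = (R * Real.cos ψ) ^ 2 by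
      linear_combination (R * Real.cos ψ) ^ 2 * Real.sin_sq_add_cos_sq φ,
    Real.sqrt_sq (by positivity)]
  congr 1
  ring

theorem norm_spherical (φ : ℝ) {R : ℝ} (ψ : ℝ) (hR : 0 ≤ R) :
    ‖(!₂[R * Real.cos ψ * Real.cos φ, R * Real.cos ψ * Real.sin φ, R * Real.sin ψ] : E3)‖ = R := by
  rw [norm_vec3, show (R * Real.cos ψ * Real.cos φ) ^ 2 + (R * Real.cos ψ * Real.sin φ) ^ 2 +
    (R * Real.sin ψ) ^ 2 = R ^ 2 by
      linear_combination (R * Real.cos ψ) ^ 2 * Real.sin_sq_add_cos_sq φ +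
        R ^ 2 * Real.sin_sq_add_cos_sq ψ, Real.sqrt_sq hR]

/-- The maximum switches from disk to apex at the latitude `ψ₀ = arctan ((1 - a sin φ) / b)`, the
complement of the edge angle. The difference of the two terms has the sign of `sin (ψ - ψ₀)`, so the
integral splits there into elementary ones. -/
theorem integral_latitude {b : ℝ} (hb : 0 < b) (a φ : ℝ) :
    ∫ ψ in -(Real.pi / 2)..Real.pi / 2,
      Real.cos ψ * max (Real.cos ψ) (a * Real.sin φ * Real.cos ψ + b * Real.sin ψ) =
    ((Real.pi - edgeAngle a b φ) + a * Real.sin φ * edgeAngle a b φ + b) / 2 := by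
  rw [edgeAngle]
  obtain ⟨t, ht⟩ : ∃ t, t = (1 - a * Real.sin φ) / b := ⟨_, rfl⟩
  rw [← ht]
  have hA : a * Real.sin φ = 1 - b * t := by
    rw [ht]
    field_simp
    ring
  rw [hA]
  have h1 := Real.neg_pi_div_two_lt_arctan t
  have h2 := Real.arctan_lt_pi_div_two t
  have hc := Real.cos_arctan_pos t
  have hs : Real.sin (Real.arctan t) = t * Real.cos (Real.arctan t) := by
    rw [← Real.tan_mul_cos hc.ne', Real.tan_arctan]
  generalize Real.arctan t = ψ₀ at *
  have hcont : Continuous fun ψ : ℝ =>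
    Real.cos ψ * max (Real.cos ψ) ((1 - b * t) * Real.cos ψ + b * Real.sin ψ) := by fun_prop
  rw [← intervalIntegral.integral_add_adjacent_intervals (b := ψ₀)
    (hcont.intervalIntegrable _ _) (hcont.intervalIntegrable _ _)]
  have hsin : ∀ ψ, Real.sin (ψ - ψ₀) = Real.cos ψ₀ * (Real.sin ψ - t * Real.cos ψ) := fun ψ => by
    rw [Real.sin_sub, hs]
    ring
  have e1 : ∫ ψ in -(Real.pi / 2)..ψ₀,
      Real.cos ψ * max (Real.cos ψ) ((1 - b * t) * Real.cos ψ + b * Real.sin ψ) =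
      ∫ ψ in -(Real.pi / 2)..ψ₀, Real.cos ψ ^ 2 := by
    refine intervalIntegral.integral_congr fun ψ hψ => ?_
    rw [Set.uIcc_of_le h1.le] at hψ
    have h := Real.sin_nonpos_of_nonpos_of_neg_pi_le (x := ψ - ψ₀) (by linarith [hψ.2])
      (by linarith [hψ.1])
    rw [hsin] at h
    have h' := nonpos_of_mul_nonpos_right h hc
    rw [max_eq_left (by nlinarith), pow_two]
  have e2 : ∫ ψ in ψ₀..Real.pi / 2,
      Real.cos ψ * max (Real.cos ψ) ((1 - b * t) * Real.cos ψ + b * Real.sin ψ) =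
      ∫ ψ in ψ₀..Real.pi / 2,
        ((1 - b * t) * Real.cos ψ ^ 2 + b * (Real.sin ψ * Real.cos ψ)) := by
    refine intervalIntegral.integral_congr fun ψ hψ => ?_
    rw [Set.uIcc_of_le h2.le] at hψ
    have h := Real.sin_nonneg_of_nonneg_of_le_pi (x := ψ - ψ₀) (by linarith [hψ.1])
      (by linarith [hψ.2])
    rw [hsin] at h
    have h' := nonneg_of_mul_nonneg_right h hc
    rw [max_eq_right (by nlinarith)]
    ring
  have i1 : IntervalIntegrable (fun ψ => (1 - b * t) * Real.cos ψ ^ 2) volume ψ₀ (Real.pi / 2) :=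
    Continuous.intervalIntegrable (by fun_prop) _ _
  have i2 : IntervalIntegrable (fun ψ => b * (Real.sin ψ * Real.cos ψ)) volume ψ₀ (Real.pi / 2) :=
    Continuous.intervalIntegrable (by fun_prop) _ _
  rw [e1, e2, intervalIntegral.integral_add i1 i2, intervalIntegral.integral_const_mul,
    intervalIntegral.integral_const_mul, integral_cos_sq, integral_cos_sq, integral_sin_mul_cos₁]
  have hsq := Real.sin_sq_add_cos_sq ψ₀
  simp only [Real.cos_neg, Real.sin_neg, Real.cos_pi_div_two, Real.sin_pi_div_two]
  have hs' : Real.cos ψ₀ * Real.sin ψ₀ * t = Real.sin ψ₀ ^ 2 := by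
    rw [pow_two]
    nth_rewrite 2 [hs]
    ring
  linear_combination b / 2 * hs'

theorem integral_latitude_nonneg {b : ℝ} (hb : 0 < b) (a φ : ℝ) :
    0 ≤ ((Real.pi - edgeAngle a b φ) + a * Real.sin φ * edgeAngle a b φ + b) / 2 := by
  rw [← integral_latitude hb]
  refine intervalIntegral.integral_nonneg (by linarith [Real.pi_pos]) fun ψ hψ => ?_
  have := Real.cos_nonneg_of_mem_Icc hψ
  exact mul_nonneg this (this.trans (le_max_left _ _))

theorem setLIntegral_ball_supportFun {b : ℝ} (hb : 0 < b) (a : ℝ) :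
    ∫⁻ x in Metric.ball (0 : E3) 1, ENNReal.ofReal (supportFun a b x) =
      4⁻¹ * ENNReal.ofReal (∫ φ in -Real.pi..Real.pi,
        ((Real.pi - edgeAngle a b φ) + a * Real.sin φ * edgeAngle a b φ + b) / 2) := by
  have hpi := Real.pi_pos
  have hm : Measurable fun x : E3 => ENNReal.ofReal (supportFun a b x) :=
    (continuous_supportFun a b).measurable.ennreal_ofReal
  rw [← lintegral_indicator measurableSet_ball,
    lintegral_spherical (hm.indicator measurableSet_ball)]
  have key : ∀ φ : ℝ, ∫⁻ q in Set.Ioi (0 : ℝ) ×ˢ Set.Ioo (-(Real.pi / 2)) (Real.pi / 2),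
      ENNReal.ofReal (q.1 ^ 2 * Real.cos q.2) *
        (Metric.ball (0 : E3) 1).indicator (fun x => ENNReal.ofReal (supportFun a b x))
          !₂[q.1 * Real.cos q.2 * Real.cos φ, q.1 * Real.cos q.2 * Real.sin φ,
            q.1 * Real.sin q.2] =
      4⁻¹ * ENNReal.ofReal
        (((Real.pi - edgeAngle a b φ) + a * Real.sin φ * edgeAngle a b φ + b) / 2) := by
    intro φ
    have hcont : Continuous fun ψ : ℝ =>
      Real.cos ψ * max (Real.cos ψ) (a * Real.sin φ * Real.cos ψ + b * Real.sin ψ) := by fun_prop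
    have h1 : ∫⁻ ψ in Set.Ioo (-(Real.pi / 2)) (Real.pi / 2), ENNReal.ofReal (Real.cos ψ *
        max (Real.cos ψ) (a * Real.sin φ * Real.cos ψ + b * Real.sin ψ)) = ENNReal.ofReal
        (((Real.pi - edgeAngle a b φ) + a * Real.sin φ * edgeAngle a b φ + b) / 2) := by
      rw [← integral_latitude hb, intervalIntegral.integral_of_le (by linarith),
        integral_Ioc_eq_integral_Ioo, ofReal_integral_eq_lintegral_ofReal]
      · exact hcont.integrableOn_Icc.mono_set Set.Ioo_subset_Icc_self
      · filter_upwards [ae_restrict_mem measurableSet_Ioo] with ψ hψ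
        have := Real.cos_nonneg_of_mem_Icc (Set.Ioo_subset_Icc_self hψ)
        exact mul_nonneg this (this.trans (le_max_left _ _))
    rw [← h1, ← lintegral_cube, ← lintegral_prod_mul (by fun_prop) (by fun_prop),
      Measure.prod_restrict, ← Measure.volume_eq_prod,
      ← lintegral_indicator (measurableSet_Ioi.prod measurableSet_Ioo),
      ← lintegral_indicator (measurableSet_Ioo.prod measurableSet_Ioo)]
    congr 1
    ext1 ⟨R, ψ⟩
    by_cases hR : 0 < R
    swap
    · rw [Set.indicator_of_notMem (s := Set.Ioi 0 ×ˢ _) (a := (R, ψ)) fun h => hR h.1,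
        Set.indicator_of_notMem (s := Set.Ioo 0 1 ×ˢ _) fun h => hR h.1.1]
    by_cases hψ : ψ ∈ Set.Ioo (-(Real.pi / 2)) (Real.pi / 2)
    swap
    · rw [Set.indicator_of_notMem (s := Set.Ioi 0 ×ˢ _) fun h => hψ h.2,
        Set.indicator_of_notMem (s := Set.Ioo 0 1 ×ˢ _) fun h => hψ h.2]
    have hc := Real.cos_nonneg_of_mem_Icc (Set.Ioo_subset_Icc_self hψ)
    rw [Set.indicator_of_mem (s := Set.Ioi 0 ×ˢ _) (a := (R, ψ)) ⟨hR, hψ⟩]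
    by_cases h1 : R < 1
    · rw [Set.indicator_of_mem (s := Set.Ioo 0 1 ×ˢ _) ⟨⟨hR, h1⟩, hψ⟩, Set.indicator_of_mem,
        supportFun_spherical a b φ hR.le hc, ← ENNReal.ofReal_mul (by positivity),
        ← ENNReal.ofReal_mul (by positivity)]
      · ring_nf
      · rwa [mem_ball_zero_iff, norm_spherical φ ψ hR.le]
    · rw [Set.indicator_of_notMem (s := Set.Ioo 0 1 ×ˢ _) fun h => h1 h.1.2,
        Set.indicator_of_notMem, mul_zero]
      rwa [mem_ball_zero_iff, norm_spherical φ ψ hR.le]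
  have hc2 : Continuous fun φ : ℝ =>
      ((Real.pi - edgeAngle a b φ) + a * Real.sin φ * edgeAngle a b φ + b) / 2 := by
    have := continuous_edgeAngle a b
    fun_prop
  simp only [key]
  rw [lintegral_const_mul _ hc2.measurable.ennreal_ofReal, intervalIntegral.integral_of_le (by linarith),
    integral_Ioc_eq_integral_Ioo, ofReal_integral_eq_lintegral_ofReal]
  · exact hc2.integrableOn_Icc.mono_set Set.Ioo_subset_Icc_self
  · exact .of_forall fun φ => integral_latitude_nonneg hb a φ

theorem toSphere_real_univ : (volume : Measure E3).toSphere.real Set.univ = 4 * Real.pi := by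
  rw [Measure.toSphere_real_apply_univ, measureReal_def, EuclideanSpace.volume_ball_fin_three]
  have h : 0 ≤ Real.pi * 4 / 3 := by positivity
  simp [ENNReal.toReal_ofReal h]
  ring

/-- The width is `h(w) + h(-w)`, with `h` the support function, so by symmetry its integral is twice
that of `h`. The factors `1/4` from passing to the ball and from the radial integral cancel, and the
sphere has area `4π`. -/
theorem meanWidth_cone {b : ℝ} (hb : 0 < b) (a : ℝ) :
    meanWidth (cone a b) = (∫ φ in -Real.pi..Real.pi,
      ((Real.pi - edgeAngle a b φ) + a * Real.sin φ * edgeAngle a b φ + b) / 2) /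
        (2 * Real.pi) := by
  have hpi := Real.pi_pos
  have hcont : Continuous (width (cone a b)) := by
    have h := continuous_supportFun a b
    have : width (cone a b) = fun w => supportFun a b w + supportFun a b (-w) :=
      funext (width_cone a b)
    rw [this]
    fun_prop
  have hnn : ∀ w, 0 ≤ width (cone a b) w := fun w => by
    rw [width_cone]
    exact add_nonneg (supportFun_nonneg a b w) (supportFun_nonneg a b _)
  have hhom := setLIntegral_ball_of_homogeneous
    (G := fun x => ENNReal.ofReal (width (cone a b) x)) hcont.measurable.ennreal_ofReal
    fun r hr x => by
      rw [← ENNReal.ofReal_mul hr.le, width_cone, width_cone, ← smul_neg, supportFun_smul a b hr.le,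
        supportFun_smul a b hr.le, mul_add]
  have hsym : ∫⁻ x in Metric.ball (0 : E3) 1, ENNReal.ofReal (supportFun a b (-x)) =
      ∫⁻ x in Metric.ball (0 : E3) 1, ENNReal.ofReal (supportFun a b x) := by
    have h := (Measure.measurePreserving_neg (volume : Measure E3)).setLIntegral_comp_preimage
      (s := Metric.ball (0 : E3) 1) measurableSet_ball
      (f := fun x => ENNReal.ofReal (supportFun a b x))
      (continuous_supportFun a b).measurable.ennreal_ofReal
    rw [← h]
    congr 2
    ext x
    simp
  have hI : 0 ≤ ∫ φ in -Real.pi..Real.pi,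
      ((Real.pi - edgeAngle a b φ) + a * Real.sin φ * edgeAngle a b φ + b) / 2 :=
    intervalIntegral.integral_nonneg (by linarith) fun φ _ => integral_latitude_nonneg hb a φ
  have hball : ∫⁻ x in Metric.ball (0 : E3) 1, ENNReal.ofReal (width (cone a b) x) =
      2 * ∫⁻ x in Metric.ball (0 : E3) 1, ENNReal.ofReal (supportFun a b x) := by
    simp only [width_cone, ENNReal.ofReal_add (supportFun_nonneg a b _) (supportFun_nonneg a b _)]
    rw [lintegral_add_left (continuous_supportFun a b).measurable.ennreal_ofReal, hsym, two_mul]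
  rw [hball, setLIntegral_ball_supportFun hb] at hhom
  have hsphere : ∫ w : Metric.sphere (0 : E3) 1, width (cone a b) w ∂(volume : Measure E3).toSphere =
      2 * ∫ φ in -Real.pi..Real.pi,
        ((Real.pi - edgeAngle a b φ) + a * Real.sin φ * edgeAngle a b φ + b) / 2 := by
    rw [integral_eq_lintegral_of_nonneg_ae (.of_forall fun w : Metric.sphere (0 : E3) 1 => hnn w)
      (hcont.comp continuous_subtype_val).aestronglyMeasurable]
    have h := congrArg ENNReal.toReal hhom
    simp only [ENNReal.toReal_mul, ENNReal.toReal_ofReal hI, ENNReal.toReal_inv] at h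
    rw [intervalIntegral.integral_div] at h ⊢
    norm_num at h
    linarith
  rw [meanWidth, average_eq, toSphere_real_univ, hsphere, smul_eq_mul]
  have h : ∀ J : ℝ, (4 * Real.pi)⁻¹ * (2 * J) = J / (2 * Real.pi) := fun J => by
    field_simp
    ring
  exact h _

/-! ### Principal branches, conjugation and the final formulas -/

theorem sqrt_re_pos {w : ℂ} (hw : w.im ≠ 0) : 0 < (Complex.sqrt w).re := by
  rw [Complex.sqrt, Complex.cpow_inv_two_re]
  apply Real.sqrt_pos.2
  have h := Complex.abs_re_lt_norm.2 hw
  linarith [(abs_lt.1 h).1]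

theorem sqrt_conj {w : ℂ} (hw : w.im ≠ 0) :
    Complex.sqrt ((starRingEnd ℂ) w) = (starRingEnd ℂ) (Complex.sqrt w) := by
  rw [Complex.sqrt, Complex.sqrt, Complex.conj_cpow _ _ fun h => hw (Complex.arg_eq_pi_iff.1 h).2]
  rw [map_inv₀, Complex.conj_ofNat]

end OC

theorem mainTheorem3 (a b : ℝ) (ha : 0 ≤ a) (hb : 0 < b) :
    (∃ m : ℝ, OC.HasIntegratedMeanCurvature (OC.cone a b) m ∧
      (m : ℂ) = (Real.pi / 2 : ℂ) *
        (Complex.sqrt ((a : ℂ) ^ 2 + ((b : ℂ) - Complex.I) ^ 2) +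
          Complex.sqrt ((a : ℂ) ^ 2 + ((b : ℂ) + Complex.I) ^ 2))) ∧
    (OC.meanWidth (OC.cone a b) : ℂ) =
      (1 / 4 : ℂ) *
        (Complex.sqrt ((a : ℂ) ^ 2 + ((b : ℂ) - Complex.I) ^ 2) +
          Complex.sqrt ((a : ℂ) ^ 2 + ((b : ℂ) + Complex.I) ^ 2)) +
      (1 / 4 : ℂ) *
        ((Real.pi : ℂ) +
          Complex.I * Complex.log ((b : ℂ) - Complex.I +
            Complex.sqrt ((a : ℂ) ^ 2 + ((b : ℂ) - Complex.I) ^ 2)) -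
          Complex.I * Complex.log ((b : ℂ) + Complex.I +
            Complex.sqrt ((a : ℂ) ^ 2 + ((b : ℂ) + Complex.I) ^ 2))) ∧
    (a = 0 → OC.meanWidth (OC.cone a b) = (b + Real.pi) / 2 - Real.arctan b / 2) := by
  have hpi := Real.pi_pos
  have him : ((a : ℂ) ^ 2 + ((b : ℂ) - Complex.I) ^ 2).im ≠ 0 := by
    simp [pow_two]
    exact hb.ne'
  have hconj : (a : ℂ) ^ 2 + ((b : ℂ) + Complex.I) ^ 2 =
      (starRingEnd ℂ) ((a : ℂ) ^ 2 + ((b : ℂ) - Complex.I) ^ 2) := by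
    simp
  have hre := OC.sqrt_re_pos him
  have hS : Complex.sqrt ((a : ℂ) ^ 2 + ((b : ℂ) - Complex.I) ^ 2) ^ 2 =
      (a : ℂ) ^ 2 + ((b : ℂ) - Complex.I) ^ 2 := by
    rw [Complex.sqrt, ← Complex.cpow_nat_mul]
    simp
  rw [hconj, OC.sqrt_conj him]
  generalize Complex.sqrt ((a : ℂ) ^ 2 + ((b : ℂ) - Complex.I) ^ 2) = S at *
  have hlog : Complex.log ((b : ℂ) + Complex.I + (starRingEnd ℂ) S) =
      (starRingEnd ℂ) (Complex.log ((b : ℂ) - Complex.I + S)) := by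
    rw [← Complex.log_conj]
    · simp
    · intro h
      have := (Complex.arg_eq_pi_iff.1 h).1
      linarith [OC.add_sqrt_re_pos hb hre]
  rw [hlog, Complex.add_conj]
  refine ⟨⟨_, OC.hasIntegratedMeanCurvature_cone hb, ?_⟩, ?_, ?_⟩
  · rw [OC.integral_curvature_density hb hS hre]
    push_cast
    ring
  · have hc := OC.continuous_edgeAngle a b
    have h : OC.meanWidth (OC.cone a b) = S.re / 2 + (Real.pi -
        2 * Complex.arg (b - Complex.I + S)) / 4 := by
      have i1 := hc.intervalIntegrable (-Real.pi) Real.pi (μ := volume)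
      have i2 : IntervalIntegrable (fun φ => a * Real.sin φ * OC.edgeAngle a b φ) volume
          (-Real.pi) Real.pi := Continuous.intervalIntegrable (by fun_prop) _ _
      rw [OC.meanWidth_cone hb, intervalIntegral.integral_div,
        intervalIntegral.integral_add ((intervalIntegrable_const.sub i1).add i2)
          intervalIntegrable_const,
        intervalIntegral.integral_add (intervalIntegrable_const.sub i1) i2,
        intervalIntegral.integral_sub intervalIntegrable_const i1,
        OC.integral_edgeAngle hb hS hre, OC.integral_sin_mul_edgeAngle hb hS hre,
        intervalIntegral.integral_const, intervalIntegral.integral_const]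
      simp only [smul_eq_mul]
      field_simp
      ring
    -- The difference of the conjugate logarithms is `2i arg w`, so the bracket in the statement is
    -- `π - 2 arg w`.
    have h2 := Complex.sub_conj (Complex.log ((b : ℂ) - Complex.I + S))
    rw [Complex.log_im] at h2
    rw [h, add_sub_assoc, ← mul_sub, h2]
    push_cast
    linear_combination (-1 / 2 : ℂ) * Complex.arg (b - Complex.I + S) * Complex.I_sq
  · rintro rfl
    rw [OC.meanWidth_cone hb]
    -- For the right cone the edge angle is constant, so the real integral gives the value with no
    -- complex formula.
    have h : ∀ φ, OC.edgeAngle 0 b φ = Real.arctan b := fun φ => by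
      rw [OC.edgeAngle, zero_mul, sub_zero, one_div, Real.arctan_inv_of_pos hb]
      ring
    simp only [h, zero_mul, add_zero, intervalIntegral.integral_const, smul_eq_mul]
    field_simp
    ring
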